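/- Let $\mathbf k$ be an imaginary quadratic field with a fixed embedding into $\mathbb C$, ring of integers $\mathcal O$, finite adeles $\hat{\mathbf k}$ and $\hat{\mathcal O}=\mathcal O\otimes\hat{\mathbb Z}$; let $\mathfrak m\subset\mathcal O$ be a nonzero ideal, $I_{\mathfrak m}$ the group of fractional ideals coprime to $\mathfrak m$, and $k\ge 1$ an integer. Let $\varrho:I_{\mathfrak m}\to\mathbb C^\times$ be an algebraic Hecke character of weight $k$ and modulus $\mathfrak m$: a homomorphism with $\varrho(\alpha\mathcal O)=\alpha^{k-1}$ whenever $\alpha\equiv 1 \bmod \mathfrak m$, where $\mathfrak m$ is the largest ideal with this property. If $k=1$, assume that $\varrho$ is not trivial. Put $\varrho(\mathfrak a)=0$ if $\mathfrak a$ is not coprime to $\mathfrak m$, and $$\vartheta_\varrho(\tau)=\sum_{0\ne\mathfrak a\subset\mathcal O}\varrho(\mathfrak a)q^{\mathrm{Nm}(\mathfrak a)},\qquad \eta(\alpha)=\varrho(\alpha\mathcal O)/\alpha^{k-1},\qquad q=e^{2\pi i\tau},\ \mathrm{Im}\,\tau>0;$$ $\eta$ induces a character of $(\mathcal O/\mathfrak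 m)^\times$. Let $K(\mathfrak m)=\{u\in\hat{\mathcal O}^\times: u\in 1+\mathfrak m\hat{\mathcal O}\}$, and let $\hat{\mathbf k}_{(\mathfrak m)}^\times$ be the group of finite ideles $t$ with $t_v\in 1+\mathfrak m\mathcal O_v$ for all $v\mid\mathfrak m$. View $\varrho$ also as the character of $\hat{\mathbf k}^\times$ that satisfies $\varrho(\alpha)=\alpha^{k-1}$ for $\alpha\in\mathbf k^\times$ and that agrees on $\hat{\mathbf k}_{(\mathfrak m)}^\times$ with the value of $\varrho$ at the associated fractional ideal. For $h\in\hat{\mathbf k}^\times$ put $\mathrm{Nm}^-(h)=h/\bar h$. For an open compact subgroup $K_{\mathrm f}\subset\hat{\mathcal O}^\times$ let $\mathrm{Cl}(K_{\mathrm f})=\mathbf k^\times\backslash\hat{\mathbf k}^\times/K_{\mathrm f}$ and $\mathrm{Vol}(K_{\mathrm f})=[\hat{\mathcal O}^\times:K_{\mathrm f}]^{-1}\,|\mathcal O^\times|\,|K_{\mathrm f}\cap\mathcal O^\times|^{-1}$. For a lattice $(P,a\,\mathrm{Nm})$, where $P\subset\mathbf k$ is a fractional ideal and $a\in\mathbb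 Q_{>0}$, for a coset $P+\mu$ with $\mu\in\mathbf k$, and for $\phi_\mu=\mathrm{char}(\hat P+\mu)$, define $$\theta_{P+\mu}(\tau,h)=\sum_{x\in\mathbf k}\phi_\mu\big((\bar h/h)x\big)x^{k-1}q^{a\mathrm{Nm}(x)},\qquad \theta_{\varrho,P+\mu}(\tau)=\mathrm{Vol}(K_{\mathrm f})\sum_{h\in\mathrm{Cl}(K_{\mathrm f})}\varrho(h/\bar h)^{-1}\,\theta_{P+\mu}(\tau,h),$$ where $K_{\mathrm f}$ is any open compact subgroup of $\hat{\mathcal O}^\times$ such that $\mathrm{Nm}^-(K_{\mathrm f})$ lies in $\ker\varrho$ and fixes $\phi_\mu$. Let $t_1,\dots,t_\ell,h_1,\dots,h_n\in\hat{\mathbf k}_{(\mathfrak m)}^\times$ be such that the $t_i\,\mathrm{Nm}^-(h_j)$ ($1\le i\le\ell$, $1\le j\le n$) form a set of representatives of $\mathrm{Cl}(K(\mathfrak m))$. Let $\mathfrak a_i$ be the fractional ideal of $t_i$, let $a_i=\mathrm{Nm}(\mathfrak a_i)$, and let $P_i$ be the lattice $(\mathfrak m\mathfrak a_i,\ a_i^{-1}\mathrm{Nm})$.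 For $\mu\in(\mathcal O/\mathfrak m)^\times$ let $P_i+\mu$ be the coset of $P_i$ of any representative of $\mu$ in $\mathcal O\cap\mathfrak a_i$. Then all the series above converge absolutely, and $$\vartheta_\varrho(\tau)=\frac{1}{\ell\,|\mathcal O^\times|}\sum_{i=1}^{\ell}\ \sum_{\mu\in(\mathcal O/\mathfrak m)^\times}\varrho(t_i)^{-1}\,\eta(\mu)\,\theta_{\varrho,P_i+\mu}(\tau).$$ Moreover, the same formula holds without the factor $1/\ell$ if the sum over all of $\mathrm{Cl}(K_{\mathrm f})$ in $\theta_{\varrho,P_i+\mu}$ is replaced by the sum over $h_1,\dots,h_n$ at level $K(\mathfrak m)$: $$\vartheta_\varrho(\tau)=\frac{1}{|\mathcal O^\times|}\sum_{i=1}^{\ell}\ \sum_{\mu\in(\mathcal O/\mathfrak m)^\times}\varrho(t_i)^{-1}\,\eta(\mu)\;\mathrm{Vol}(K(\mathfrak m))\sum_{j=1}^{n}\varrho(h_j/\bar h_j)^{-1}\,\theta_{P_i+\mu}(\tau,h_j).$$ -/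

import Mathlib

open NumberField IsDedekindDomain nonZeroDivisors UpperHalfPlane

noncomputable section
namespace CMTheta

variable {K : Type*} [Field K]

/-- The prime `e⁻¹(w)`, for an automorphism `e` of `K`. -/
def primeComap (e : K ≃+* K) (w : HeightOneSpectrum (𝓞 K)) : HeightOneSpectrum (𝓞 K) :=
  w.comap (RingOfIntegers.mapRingEquiv e : 𝓞 K →+* 𝓞 K) (RingOfIntegers.mapRingEquiv e).surjective

theorem primeComap_injective (e : K ≃+* K) : Function.Injective (primeComap e) := by
  intro v w h
  have h1 := congrArg HeightOneSpectrum.asIdeal h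
  apply HeightOneSpectrum.ext
  exact Ideal.comap_injective_of_surjective _ (RingOfIntegers.mapRingEquiv e).surjective h1

theorem mem_primeComap_pow (e : K ≃+* K) (w : HeightOneSpectrum (𝓞 K)) (n : ℕ) (r : 𝓞 K) :
    r ∈ (primeComap e w).asIdeal ^ n ↔ RingOfIntegers.mapRingEquiv e r ∈ w.asIdeal ^ n := by
  set f := RingOfIntegers.mapRingEquiv e
  have h1 : (primeComap e w).asIdeal = w.asIdeal.map f.symm := Ideal.comap_symm f.symm
  rw [h1, ← Ideal.map_pow, Ideal.map_symm]
  rfl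

variable [NumberField K]

theorem intValuation_primeComap (e : K ≃+* K) (w : HeightOneSpectrum (𝓞 K)) (r : 𝓞 K) :
    (primeComap e w).intValuation r = w.intValuation (RingOfIntegers.mapRingEquiv e r) := by
  by_cases hr : r = 0
  · simp [hr]
  have hr' : RingOfIntegers.mapRingEquiv e r ≠ 0 := by simpa using hr
  have key : ∀ n : ℕ, (primeComap e w).intValuation r ≤ WithZero.exp (-(n : ℤ)) ↔
      w.intValuation (RingOfIntegers.mapRingEquiv e r) ≤ WithZero.exp (-(n : ℤ)) := by
    intro n
    rw [HeightOneSpectrum.intValuation_le_pow_iff_mem, HeightOneSpectrum.intValuation_le_pow_iff_mem,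
      mem_primeComap_pow]
  rw [HeightOneSpectrum.intValuation_if_neg _ hr, HeightOneSpectrum.intValuation_if_neg _ hr'] at *
  apply le_antisymm
  · exact (key _).2 le_rfl
  · exact (key _).1 le_rfl

theorem valuation_primeComap (e : K ≃+* K) (w : HeightOneSpectrum (𝓞 K)) (x : K) :
    (primeComap e w).valuation K x = w.valuation K (e x) := by
  obtain ⟨a, b, hb, rfl⟩ := IsFractionRing.div_surjective (A := 𝓞 K) x
  have h : ∀ r : 𝓞 K, e (algebraMap (𝓞 K) K r) =
    algebraMap (𝓞 K) K (RingOfIntegers.mapRingEquiv e r) := fun r => rfl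
  simp only [map_div₀, h, HeightOneSpectrum.valuation_of_algebraMap, intValuation_primeComap]

theorem continuous_withValMap (e : K ≃+* K) (w : HeightOneSpectrum (𝓞 K)) :
    Continuous (WithVal.map ((primeComap e w).valuation K) (w.valuation K) (e : K →+* K)) := by
  apply continuous_of_continuousAt_zero
  rw [ContinuousAt, map_zero]
  intro s hs
  obtain ⟨γ, hγ⟩ := Valued.mem_nhds_zero.1 hs
  obtain ⟨y, hy⟩ := MonoidWithZeroHom.ValueGroup₀.restrict₀_surjective _ γ.val
  rw [Filter.mem_map, Valued.mem_nhds_zero]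
  have hy0 : y ≠ 0 := by
    rintro rfl
    rw [map_zero] at hy
    exact γ.ne_zero hy.symm
  let z : WithVal ((primeComap e w).valuation K) := WithVal.toVal _ (e.symm y.ofVal)
  have hz : z ≠ 0 := by simpa [z] using hy0
  have hz0 : Valued.v.restrict z ≠ 0 := by
    rw [Ne, map_eq_zero]
    exact hz
  refine ⟨Units.mk0 (Valued.v.restrict z) hz0, fun x hx => hγ ?_⟩
  have hx' : Valued.v.restrict x < Valued.v.restrict z := hx
  rw [Valuation.restrict_lt_iff] at hx'
  change Valued.v.restrict _ < γ.val
  rw [← hy]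
  change Valued.v.restrict _ < Valued.v.restrict y
  rw [Valuation.restrict_lt_iff]
  rw [← WithVal.apply_ofVal, ← WithVal.apply_ofVal] at hx' ⊢
  rw [valuation_primeComap, valuation_primeComap] at hx'
  simpa [z] using hx'

/-- The isomorphism of completions `K_{e⁻¹ w} → K_w` induced by an automorphism `e` of `K`. -/
def completionMap (e : K ≃+* K) (w : HeightOneSpectrum (𝓞 K)) :
    (primeComap e w).adicCompletion K →+* w.adicCompletion K :=
  ((HeightOneSpectrum.adicCompletion.equiv K w).symm : _ →+* _).comp
    ((UniformSpace.Completion.mapRingHom _ (continuous_withValMap e w)).comp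
      (HeightOneSpectrum.adicCompletion.equiv K (primeComap e w) : _ →+* _))

theorem completionMap_coe (e : K ≃+* K) (w : HeightOneSpectrum (𝓞 K)) (x : K) :
    completionMap e w (x : (primeComap e w).adicCompletion K) = ((e x : K) : w.adicCompletion K) := by
  apply HeightOneSpectrum.adicCompletion.ext
  exact UniformSpace.Completion.mapRingHom_coe (continuous_withValMap e w) _

theorem completionMap_mapsTo (e : K ≃+* K) (w : HeightOneSpectrum (𝓞 K)) :
    Set.MapsTo (completionMap e w) ((primeComap e w).adicCompletionIntegers K)
      (w.adicCompletionIntegers K) := by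
  have key : ∀ y : ((primeComap e w).valuation K).Completion, Valued.v y ≤ 1 →
      Valued.v (UniformSpace.Completion.mapRingHom _ (continuous_withValMap e w) y) ≤ 1 := by
    intro y
    induction y using UniformSpace.Completion.induction_on with
    | hp =>
      simp only [imp_iff_not_or]
      refine IsClosed.union ?_ ?_
      · exact (Valued.isOpen_integer ((primeComap e w).valuation K).Completion).isClosed_compl
      · have hc : Continuous (UniformSpace.Completion.mapRingHom _ (continuous_withValMap e w)) :=
          UniformSpace.Completion.continuous_map
        exact (Valued.isClosed_integer (w.valuation K).Completion).preimage hc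
    | ih a =>
      rw [UniformSpace.Completion.mapRingHom_coe, Valued.valuedCompletion_apply,
        Valued.valuedCompletion_apply, ← WithVal.apply_ofVal, ← WithVal.apply_ofVal,
        valuation_primeComap]
      exact id
  intro x hx
  exact key x.toCompletion hx

/-- The automorphism of the finite adele ring of `K` induced by an automorphism `e` of `K`. -/
def adeleMap (e : K ≃+* K) : FiniteAdeleRing (𝓞 K) K →+* FiniteAdeleRing (𝓞 K) K :=
  RestrictedProduct.mapAlongRingHom
    (fun v : HeightOneSpectrum (𝓞 K) => v.adicCompletion K)
    (fun v : HeightOneSpectrum (𝓞 K) => v.adicCompletion K)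
    (primeComap e) (primeComap_injective e).tendsto_cofinite
    (completionMap e) (Filter.Eventually.of_forall (completionMap_mapsTo e))

theorem adeleMap_apply (e : K ≃+* K) (x : FiniteAdeleRing (𝓞 K) K) (w : HeightOneSpectrum (𝓞 K)) :
    adeleMap e x w = completionMap e w (x (primeComap e w)) := rfl

theorem adeleMap_algebraMap (e : K ≃+* K) (x : K) :
    adeleMap e (algebraMap K _ x) = algebraMap K _ (e x) := by
  apply FiniteAdeleRing.ext
  intro w
  exact completionMap_coe e w x

/-! ### Complex conjugation and the map `Nm⁻` -/

section Conj

variable (K) [Algebra.IsQuadraticExtension ℚ K] [IsTotallyComplex K]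

/-- The nontrivial automorphism `z ↦ z̄` of the imaginary quadratic field `K`. -/
def conj : K ≃+* K :=
  haveI : IsCMField K := IsCMField.ofCMExtension ℚ K
  (IsCMField.complexConj K).toRingEquiv

theorem embedding_conj (σ : K →+* ℂ) (x : K) : σ (conj K x) = star (σ x) :=
  haveI : IsCMField K := IsCMField.ofCMExtension ℚ K
  IsCMField.complexEmbedding_complexConj K σ x

/-- The homomorphism `Nm⁻ : h ↦ h / h̄` on finite ideles of `K`. -/
def normMinus : (FiniteAdeleRing (𝓞 K) K)ˣ →* (FiniteAdeleRing (𝓞 K) K)ˣ :=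
  MonoidHom.id _ / Units.map (adeleMap (conj K) : FiniteAdeleRing (𝓞 K) K →* _)

end Conj

/-! ### Lattices, congruence subgroups and class groups -/

/-- The completion `P_v ⊆ K_v` of a fractional ideal `P` of `K`. -/
def localIdeal (v : HeightOneSpectrum (𝓞 K)) (P : FractionalIdeal (𝓞 K)⁰ K) :
    Submodule (v.adicCompletionIntegers K) (v.adicCompletion K) :=
  Submodule.span _ ((fun x : K => (x : v.adicCompletion K)) '' {x : K | x ∈ P})

/-- The open compact subset `P̂ = P ⊗ ℤ̂ = ∏ᵥ P_v` of the finite adeles. -/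
def hat (P : FractionalIdeal (𝓞 K)⁰ K) : Set (FiniteAdeleRing (𝓞 K) K) :=
  {x | ∀ v, x v ∈ localIdeal v P}

/-- The characteristic function `φ_{P + μ}` of `μ + P̂`. -/
def cosetIndicator (P : FractionalIdeal (𝓞 K)⁰ K) (μ : K) : FiniteAdeleRing (𝓞 K) K → ℂ :=
  Set.indicator {x | x - algebraMap K _ μ ∈ hat P} 1

variable (K) in
/-- The maximal compact subgroup `Ô_K^×` of the finite ideles. -/
def integralUnits : Subgroup (FiniteAdeleRing (𝓞 K) K)ˣ where
  carrier := {u | ∀ v, Valued.v ((u : FiniteAdeleRing (𝓞 K) K) v) = 1}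
  one_mem' v := map_one _
  mul_mem' {a b} ha hb v := by
    have h : ((a * b : (FiniteAdeleRing (𝓞 K) K)ˣ) : FiniteAdeleRing (𝓞 K) K) v =
      (a : FiniteAdeleRing (𝓞 K) K) v * (b : FiniteAdeleRing (𝓞 K) K) v := rfl
    rw [h, map_mul, ha v, hb v, one_mul]
  inv_mem' {a} ha v := by
    have h : (a : FiniteAdeleRing (𝓞 K) K) v *
      ((a⁻¹ : (FiniteAdeleRing (𝓞 K) K)ˣ) : FiniteAdeleRing (𝓞 K) K) v = 1 :=
      congrArg (fun x : FiniteAdeleRing (𝓞 K) K => x v) a.mul_inv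
    have h2 := congrArg Valued.v h
    rwa [map_mul, ha v, one_mul, map_one] at h2

/-- `K(𝔪) = ∏_{v ∤ 𝔪} O_v^× × ∏_{v ∣ 𝔪} (1 + 𝔪 O_v)`, written uniformly as the group of the
units `u` of `Ô_K` with `u - 1 ∈ 𝔪 O_v` for all `v`. -/
def levelSubgroup (m : Ideal (𝓞 K)) : Subgroup (FiniteAdeleRing (𝓞 K) K)ˣ where
  carrier := {u | u ∈ integralUnits K ∧
    ∀ v, (u : FiniteAdeleRing (𝓞 K) K) v - 1 ∈ localIdeal v (m : FractionalIdeal (𝓞 K)⁰ K)}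
  one_mem' := ⟨one_mem _, fun v => by
    have h : ((1 : (FiniteAdeleRing (𝓞 K) K)ˣ) : FiniteAdeleRing (𝓞 K) K) v = 1 := rfl
    rw [h, sub_self]; exact zero_mem _⟩
  mul_mem' {a b} ha hb := ⟨mul_mem ha.1 hb.1, fun v => by
    have h : ((a * b : (FiniteAdeleRing (𝓞 K) K)ˣ) : FiniteAdeleRing (𝓞 K) K) v =
      (a : FiniteAdeleRing (𝓞 K) K) v * (b : FiniteAdeleRing (𝓞 K) K) v := rfl
    have e : (a : FiniteAdeleRing (𝓞 K) K) v * (b : FiniteAdeleRing (𝓞 K) K) v - 1 =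
      (a : FiniteAdeleRing (𝓞 K) K) v * ((b : FiniteAdeleRing (𝓞 K) K) v - 1) +
        ((a : FiniteAdeleRing (𝓞 K) K) v - 1) := by ring
    rw [h, e]
    exact add_mem (Submodule.smul_mem _
      (⟨_, (ha.1 v).le⟩ : v.adicCompletionIntegers K) (hb.2 v)) (ha.2 v)⟩
  inv_mem' {a} ha := ⟨inv_mem ha.1, fun v => by
    have h : (a : FiniteAdeleRing (𝓞 K) K) v *
      ((a⁻¹ : (FiniteAdeleRing (𝓞 K) K)ˣ) : FiniteAdeleRing (𝓞 K) K) v = 1 :=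
      congrArg (fun x : FiniteAdeleRing (𝓞 K) K => x v) a.mul_inv
    have e : ((a⁻¹ : (FiniteAdeleRing (𝓞 K) K)ˣ) : FiniteAdeleRing (𝓞 K) K) v - 1 =
      -(((a⁻¹ : (FiniteAdeleRing (𝓞 K) K)ˣ) : FiniteAdeleRing (𝓞 K) K) v *
        ((a : FiniteAdeleRing (𝓞 K) K) v - 1)) := by linear_combination h
    rw [e]
    exact neg_mem (Submodule.smul_mem _
      (⟨_, ((inv_mem ha.1 : a⁻¹ ∈ integralUnits K) v).le⟩ : v.adicCompletionIntegers K) (ha.2 v))⟩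

/-- `K̂_{(𝔪)}^×`: the finite ideles `t` with `t_v ∈ 1 + 𝔪 O_v` for all `v ∣ 𝔪`. -/
def coprimeIdeles (m : Ideal (𝓞 K)) : Set (FiniteAdeleRing (𝓞 K) K)ˣ :=
  {t | ∀ v : HeightOneSpectrum (𝓞 K), m ≤ v.asIdeal →
    (t : FiniteAdeleRing (𝓞 K) K) v - 1 ∈ localIdeal v (m : FractionalIdeal (𝓞 K)⁰ K)}

/-- `Cl(K_f) = K^× \ K̂^× / K_f`. -/
abbrev IdeleClassGroup (Kf : Subgroup (FiniteAdeleRing (𝓞 K) K)ˣ) : Type _ :=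
  (FiniteAdeleRing (𝓞 K) K)ˣ ⧸ ((FiniteAdeleRing.unitEmbedding (𝓞 K) K).range ⊔ Kf)

/-- `Vol(K_f) = [Ô_K^× : K_f]⁻¹ · |O_K^×| · |K_f ∩ O_K^×|⁻¹`. -/
def vol (Kf : Subgroup (FiniteAdeleRing (𝓞 K) K)ˣ) : ℂ :=
  ((Kf.relIndex (integralUnits K) : ℂ))⁻¹ * (Nat.card (𝓞 K)ˣ : ℂ) *
    (Nat.card ↥(Kf ⊓ (Units.map
      (algebraMap (𝓞 K) (FiniteAdeleRing (𝓞 K) K) : 𝓞 K →* _)).range) : ℂ)⁻¹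

/-- The fractional ideal `∏ᵥ 𝔭_v ^ {ord_v(t_v)}` of a finite idele `t`. -/
def ideleIdeal (t : (FiniteAdeleRing (𝓞 K) K)ˣ) : (FractionalIdeal (𝓞 K)⁰ K)ˣ :=
  ∏ᶠ v : HeightOneSpectrum (𝓞 K),
    (FractionalIdeal.mk0 K ⟨v.asIdeal, mem_nonZeroDivisors_of_ne_zero v.ne_bot⟩) ^
      (-WithZero.log (Valued.v ((t : FiniteAdeleRing (𝓞 K) K) v)))

/-- `I_𝔪`: the group of fractional ideals of `K` coprime to `𝔪`. -/
def coprimeIdeals (m : Ideal (𝓞 K)) : Subgroup (FractionalIdeal (𝓞 K)⁰ K)ˣ where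
  carrier := {a | ∀ v : HeightOneSpectrum (𝓞 K), m ≤ v.asIdeal →
    FractionalIdeal.count K v (a : FractionalIdeal (𝓞 K)⁰ K) = 0}
  one_mem' v _ := FractionalIdeal.count_one K v
  mul_mem' {a b} ha hb v hv := by
    rw [Units.val_mul, FractionalIdeal.count_mul K v a.ne_zero b.ne_zero, ha v hv, hb v hv,
      add_zero]
  inv_mem' {a} ha v hv := by
    rw [Units.val_inv_eq_inv_val, FractionalIdeal.count_inv, ha v hv, neg_zero]

/-! ### Algebraic Hecke characters -/

/-- An algebraic Hecke character of weight `k` on `I_𝔪` (with `K` embedded in `ℂ` by `σ`): a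
homomorphism on `I_𝔪` with `ϱ(αO) = α^{k-1}` for all `α ≡ 1 mod 𝔪`, that is, `α ∈ 1 + 𝔪 O_v` for
all `v ∣ 𝔪`. -/
structure HeckeCharacter (σ : K →+* ℂ) (k : ℕ) (m : Ideal (𝓞 K)) where
  /-- The homomorphism on `I_𝔪`. -/
  toHom : coprimeIdeals m →* ℂˣ
  map_principal : ∀ (α : Kˣ) (hα : toPrincipalIdeal (𝓞 K) K α ∈ coprimeIdeals m),
    FiniteAdeleRing.unitEmbedding (𝓞 K) K α ∈ coprimeIdeles m →
      (toHom ⟨toPrincipalIdeal (𝓞 K) K α, hα⟩ : ℂ) = σ α ^ (k - 1)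

namespace HeckeCharacter

variable {σ : K →+* ℂ} {k : ℕ} {m : Ideal (𝓞 K)} (ϱ : HeckeCharacter σ k m)

/-- `ϱ` has modulus `𝔪`: no ideal `𝔣 ⊋ 𝔪` has the property that `ϱ(αO) = α^{k-1}` for all
`αO ∈ I_𝔪` with `α ≡ 1 mod 𝔣`. -/
def HasModulus : Prop :=
  ∀ f : Ideal (𝓞 K), m ≤ f →
    (∀ (α : Kˣ) (hα : toPrincipalIdeal (𝓞 K) K α ∈ coprimeIdeals m),
      FiniteAdeleRing.unitEmbedding (𝓞 K) K α ∈ coprimeIdeles f →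
        (ϱ.toHom ⟨toPrincipalIdeal (𝓞 K) K α, hα⟩ : ℂ) = σ α ^ (k - 1)) → f = m

open Classical in
/-- `ϱ(𝔞)`, extended by zero to the ideals not coprime to `𝔪`. -/
def onIdeal (a : (FractionalIdeal (𝓞 K)⁰ K)ˣ) : ℂ :=
  if ha : a ∈ coprimeIdeals m then (ϱ.toHom ⟨a, ha⟩ : ℂ) else 0

/-- `η(α) = ϱ(αO) / α^{k-1}`. -/
def eta (α : Kˣ) : ℂ := ϱ.onIdeal (toPrincipalIdeal (𝓞 K) K α) / σ α ^ (k - 1)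

open Classical in
/-- `ϱ` as a character of the finite ideles: the homomorphism on `K̂^×` with
`ϱ(α) = α^{k-1}` for `α ∈ K^×` and `ϱ(t) = ϱ(𝔞)` if `t ∈ K̂_{(𝔪)}^×` has the ideal `𝔞`. Its value
at `h` is obtained by choosing `α ∈ K^×` with `αh ∈ K̂_{(𝔪)}^×`; it does not depend on `α`. -/
def onIdele (h : (FiniteAdeleRing (𝓞 K) K)ˣ) : ℂ :=
  if H : ∃ α : Kˣ, FiniteAdeleRing.unitEmbedding (𝓞 K) K α * h ∈ coprimeIdeles m then
    (σ H.choose ^ (k - 1))⁻¹ *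
      ϱ.onIdeal (ideleIdeal (FiniteAdeleRing.unitEmbedding (𝓞 K) K H.choose * h))
  else 0

/-- The term `ϱ(𝔞) q^{Nm 𝔞}`, `q = e^{2πiτ}`, of the form `ϑ_ϱ`, for a nonzero integral ideal `𝔞`. -/
def formTerm (τ : ℍ) (a : (Ideal (𝓞 K))⁰) : ℂ :=
  ϱ.onIdeal (FractionalIdeal.mk0 K a) *
    Complex.exp (2 * Real.pi * Complex.I * τ * (Ideal.absNorm (a : Ideal (𝓞 K)) : ℂ))

/-- The form `ϑ_ϱ(τ) = ∑_𝔞 ϱ(𝔞) q^{Nm 𝔞}`. -/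
def form (τ : ℍ) : ℂ := ∑' a : (Ideal (𝓞 K))⁰, ϱ.formTerm τ a

end HeckeCharacter

/-! ### Binary theta series -/

section Theta

variable [Algebra.IsQuadraticExtension ℚ K] [IsTotallyComplex K]

/-- The term `φ((h̄/h) x) x^{k-1} q^{a Nm x}` of the theta series of the quadratic space
`(K, a Nm)`. -/
def thetaTerm (σ : K →+* ℂ) (k : ℕ) (a : ℚ) (φ : FiniteAdeleRing (𝓞 K) K → ℂ)
    (h : (FiniteAdeleRing (𝓞 K) K)ˣ) (τ : ℍ) (x : K) : ℂ :=
  φ (((normMinus K h)⁻¹ : (FiniteAdeleRing (𝓞 K) K)ˣ) * algebraMap K _ x) * σ x ^ (k - 1) *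
    Complex.exp (2 * Real.pi * Complex.I * τ * ((a * Algebra.norm ℚ x : ℚ) : ℂ))

/-- The theta series `θ(τ, ω(h)φ) = ∑_{x ∈ K} φ((h̄/h) x) x^{k-1} q^{a Nm x}`. -/
def theta (σ : K →+* ℂ) (k : ℕ) (a : ℚ) (φ : FiniteAdeleRing (𝓞 K) K → ℂ)
    (h : (FiniteAdeleRing (𝓞 K) K)ˣ) (τ : ℍ) : ℂ :=
  ∑' x : K, thetaTerm σ k a φ h τ x

variable {σ : K →+* ℂ} {k : ℕ} {m : Ideal (𝓞 K)}

/-- `K_f` is an open (compact) subgroup of `Ô_K^×` such that `Nm⁻(K_f)` lies in the kernel of `ϱ`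
and fixes `φ`; the twisted theta series of `φ` can then be computed at level `K_f`. -/
structure IsLevel (ϱ : HeckeCharacter σ k m) (φ : FiniteAdeleRing (𝓞 K) K → ℂ)
    (Kf : Subgroup (FiniteAdeleRing (𝓞 K) K)ˣ) : Prop where
  isOpen : IsOpen (Kf : Set (FiniteAdeleRing (𝓞 K) K)ˣ)
  le_integralUnits : Kf ≤ integralUnits K
  map_eq_one : ∀ u ∈ Kf, ϱ.onIdele (normMinus K u) = 1
  fixes : ∀ u ∈ Kf, ∀ x : FiniteAdeleRing (𝓞 K) K,
    φ (((normMinus K u)⁻¹ : (FiniteAdeleRing (𝓞 K) K)ˣ) * x) = φ x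

/-- The twisted theta series
`θ_ϱ(τ, φ) = Vol(K_f) ∑_{h ∈ Cl(K_f)} ϱ(h/h̄)⁻¹ ∑_{x ∈ K} φ((h̄/h) x) x^{k-1} q^{a Nm x}`
for the quadratic space `(K, a Nm)` (for `K_f` with `IsLevel ϱ φ K_f` the summands depend only on
the classes, and the sum does not depend on `K_f`). -/
def twistedTheta (ϱ : HeckeCharacter σ k m) (Kf : Subgroup (FiniteAdeleRing (𝓞 K) K)ˣ) (a : ℚ)
    (φ : FiniteAdeleRing (𝓞 K) K → ℂ) (τ : ℍ) : ℂ :=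
  vol Kf * ∑ᶠ c : IdeleClassGroup Kf,
    (ϱ.onIdele (normMinus K c.out))⁻¹ * theta σ k a φ c.out τ

end Theta

end CMTheta
end

/-! Fix `t` and `h`, and choose `α ∈ K^×` such that `u = α h/h̄` is congruent to 1 at the primes
dividing `𝔪`. Let `B` be the ideal of `ut`. Substituting `x = α⁻¹ y` in the theta series turns the
adelic coset condition into `y ∈ B` together with `y ≡ μ` at the primes dividing `𝔪`
(`cosetIndicator_apply`). Summing `η(μ) y^{k-1}` over `μ` then gives `ϱ(yO)`, which is zero if `y`
is not prime to `𝔪` (`sum_eta_mul`). The factors `ϱ(t)⁻¹ ϱ(h/h̄)⁻¹` turn this into `ϱ(yB⁻¹)`. The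
ideal of `h/h̄` has norm 1, so the exponent of `q` becomes `Nm(yB⁻¹)` (`sum_thetaTerm`).

As `y` runs through the nonzero elements of `B`, the ideal `yB⁻¹` runs through the integral ideals
in the class of `B⁻¹`, each occurring `|O^×|` times (`tsum_classTerm`). The term `y = 0` contributes
only for `k = 1` and `𝔪 = O`; it is then `ϱ(B)⁻¹`, where `ϱ` is a character of the class group.
Hence the sum over `μ` depends only on the ideal class of `t h/h̄` (`thetaSum_eq`). Summed over all
classes it gives `|O^×| ϑ_ϱ`, because the constant terms of a nontrivial character cancel
(`sum_classValue`).

It remains to count classes. The representatives `t_i h_j/h̄_j` cover every ideal class equally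
often, since `Cl(K(𝔪)) → Cl(K)` is a surjective homomorphism. For the sum over all of `Cl(K_f)`,
invariance under translation by `h_j` brings in an average over `j`, and this produces the extra
factor `ℓ` (`sum_classGroup_twisted`). The volume is normalized so that `Vol(K_f) |Cl(K_f)|` is the
class number for every `K_f` (`vol_mul_index`). -/

noncomputable section
namespace CMTheta

/-! ### Fractional ideals and their completions in terms of valuations. -/

section Ideals

variable {K : Type*} [Field K] [NumberField K]

open FractionalIdeal in
theorem valuation_eq_exp_neg_count (v : HeightOneSpectrum (𝓞 K)) {x : K} (hx : x ≠ 0) :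
    v.valuation K x = WithZero.exp (-(count K v (spanSingleton (𝓞 K)⁰ x))) := by
  obtain ⟨a, b, hb, rfl⟩ := IsFractionRing.div_surjective (A := 𝓞 K) x
  have hb0 : b ≠ 0 := nonZeroDivisors.ne_zero hb
  have ha0 : a ≠ 0 := by rintro rfl; simp at hx
  rw [count_well_defined K v (a := b) (J := Ideal.span {a})]
  · rw [map_div₀, HeightOneSpectrum.valuation_of_algebraMap,
      HeightOneSpectrum.valuation_of_algebraMap, HeightOneSpectrum.intValuation_if_neg _ ha0,
      HeightOneSpectrum.intValuation_if_neg _ hb0, ← WithZero.exp_sub]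
    congr 1
    ring
  · exact spanSingleton_ne_zero_iff.2 hx
  · rw [coeIdeal_span_singleton, spanSingleton_mul_spanSingleton, div_eq_inv_mul]

theorem le_one_of_count_nonneg {P : FractionalIdeal (𝓞 K)⁰ K}
    (h : ∀ v, 0 ≤ FractionalIdeal.count K v P) : P ≤ 1 := by
  rcases eq_or_ne P 0 with rfl | hP
  · exact zero_le
  rw [← FractionalIdeal.finprod_heightOneSpectrum_factorization' K hP]
  apply finprod_induction (p := fun I : FractionalIdeal (𝓞 K)⁰ K => I ≤ 1)
  · exact le_rfl
  · intro I J hI hJ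
    exact mul_le_one' hI hJ
  · intro v
    obtain ⟨n, hn⟩ := Int.eq_ofNat_of_zero_le (h v)
    rw [hn, zpow_natCast]
    exact pow_le_one' FractionalIdeal.coeIdeal_le_one n

theorem le_iff_count_le {P Q : FractionalIdeal (𝓞 K)⁰ K} (hP : P ≠ 0) (hQ : Q ≠ 0) :
    P ≤ Q ↔ ∀ v, FractionalIdeal.count K v Q ≤ FractionalIdeal.count K v P := by
  refine ⟨fun h v => FractionalIdeal.count_mono K v hP h, fun h => ?_⟩
  have : P * Q⁻¹ ≤ 1 := by
    apply le_one_of_count_nonneg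
    intro v
    rw [FractionalIdeal.count_mul K v hP (inv_ne_zero hQ), FractionalIdeal.count_inv]
    linarith [h v]
  calc P = P * Q⁻¹ * Q := by rw [mul_assoc, inv_mul_cancel₀ hQ, mul_one]
    _ ≤ 1 * Q := mul_le_mul_left this Q
    _ = Q := one_mul Q

theorem mem_iff_valuation_le {P : FractionalIdeal (𝓞 K)⁰ K} (hP : P ≠ 0) (x : K) :
    x ∈ P ↔ ∀ v, v.valuation K x ≤ WithZero.exp (-FractionalIdeal.count K v P) := by
  rcases eq_or_ne x 0 with rfl | hx
  · simpa using P.zero_mem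
  rw [← FractionalIdeal.spanSingleton_le_iff_mem,
    le_iff_count_le (FractionalIdeal.spanSingleton_ne_zero_iff.2 hx) hP]
  simp_rw [valuation_eq_exp_neg_count _ hx, WithZero.exp_le_exp, neg_le_neg_iff]

/-- If every element of `P` had strictly larger order at `v`, then `P ⊆ P𝔭_v`, which contradicts the
count at `v`. -/
theorem exists_mem_valuation_eq (v : HeightOneSpectrum (𝓞 K)) {P : FractionalIdeal (𝓞 K)⁰ K}
    (hP : P ≠ 0) : ∃ x ∈ P, v.valuation K x = WithZero.exp (-FractionalIdeal.count K v P) := by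
  by_contra! h
  have hv : (v.asIdeal : FractionalIdeal (𝓞 K)⁰ K) ≠ 0 :=
    FractionalIdeal.coeIdeal_ne_zero.2 v.ne_bot
  have hle : P ≤ P * v.asIdeal := by
    intro x hx
    rw [mem_iff_valuation_le (mul_ne_zero hP hv)]
    have hx' := (mem_iff_valuation_le hP x).1 hx
    intro w
    rw [FractionalIdeal.count_mul K w hP hv]
    by_cases hw : v = w
    · subst hw
      rw [FractionalIdeal.count_self]
      rcases eq_or_ne x 0 with rfl | hx0
      · simp
      have h1 := lt_of_le_of_ne (hx' v) (h x hx)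
      rw [valuation_eq_exp_neg_count _ hx0] at h1 ⊢
      rw [WithZero.exp_lt_exp] at h1
      rw [WithZero.exp_le_exp]
      linarith
    · rw [FractionalIdeal.count_maximal_coprime K w hw, add_zero]
      exact hx' w
  have := FractionalIdeal.count_mono K v hP hle
  rw [FractionalIdeal.count_mul K v hP hv, FractionalIdeal.count_self] at this
  linarith

/-- An element of `P` of minimal order at `v` generates the completion. All later adelic conditions
are checked through this valuation inequality. -/
theorem mem_localIdeal_iff (v : HeightOneSpectrum (𝓞 K)) {P : FractionalIdeal (𝓞 K)⁰ K}
    (hP : P ≠ 0) (x : v.adicCompletion K) :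
    x ∈ localIdeal v P ↔ Valued.v x ≤ WithZero.exp (-FractionalIdeal.count K v P) := by
  constructor
  · intro hx
    induction hx using Submodule.span_induction with
    | mem y hy =>
      obtain ⟨p, hp, rfl⟩ := hy
      rw [HeightOneSpectrum.valuedAdicCompletion_eq_valuation']
      exact (mem_iff_valuation_le hP p).1 hp v
    | zero => simp
    | add y z _ _ hy hz => exact (Valuation.map_add _ _ _).trans (max_le hy hz)
    | smul a y _ hy =>
      have : a • y = (a : v.adicCompletion K) * y := rfl
      rw [this, map_mul]
      exact (mul_le_mul' a.2 hy).trans (one_mul _).le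
  · intro hx
    obtain ⟨p, hp, hpv⟩ := exists_mem_valuation_eq v hP
    have hp0 : v.valuation K p ≠ 0 := by rw [hpv]; exact WithZero.exp_ne_zero
    rw [← HeightOneSpectrum.valuedAdicCompletion_eq_valuation'] at hp0 hpv
    have hp1 : (p : v.adicCompletion K) ≠ 0 := (Valuation.ne_zero_iff _).1 hp0
    have hmem : x / (p : v.adicCompletion K) ∈ v.adicCompletionIntegers K := by
      rw [HeightOneSpectrum.mem_adicCompletionIntegers, map_div₀, hpv]
      exact div_le_one_of_le₀ hx zero_le
    have : x = (⟨_, hmem⟩ : v.adicCompletionIntegers K) • (p : v.adicCompletion K) :=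
      (div_mul_cancel₀ x hp1).symm
    rw [this]
    exact Submodule.smul_mem _ _ (Submodule.subset_span ⟨p, hp, rfl⟩)

theorem fractionalIdeal_units_ext {I J : (FractionalIdeal (𝓞 K)⁰ K)ˣ}
    (h : ∀ v, FractionalIdeal.count K v (I : FractionalIdeal (𝓞 K)⁰ K) =
      FractionalIdeal.count K v (J : FractionalIdeal (𝓞 K)⁰ K)) : I = J :=
  Units.ext (le_antisymm ((le_iff_count_le I.ne_zero J.ne_zero).2 fun v => (h v).ge)
    ((le_iff_count_le J.ne_zero I.ne_zero).2 fun v => (h v).le))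

end Ideals

/-! ### The ideal attached to a finite idele. -/

section Ideles

variable {K : Type*} [Field K] [NumberField K]

theorem idele_apply_ne_zero (t : (FiniteAdeleRing (𝓞 K) K)ˣ) (v : HeightOneSpectrum (𝓞 K)) :
    (t : FiniteAdeleRing (𝓞 K) K) v ≠ 0 :=
  (FiniteAdeleRing.isUnit_iff.1 t.isUnit).1 v

theorem idele_mul_apply (s t : (FiniteAdeleRing (𝓞 K) K)ˣ) (v : HeightOneSpectrum (𝓞 K)) :
    ((s * t : (FiniteAdeleRing (𝓞 K) K)ˣ) : FiniteAdeleRing (𝓞 K) K) v =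
      (s : FiniteAdeleRing (𝓞 K) K) v * (t : FiniteAdeleRing (𝓞 K) K) v := rfl

theorem idele_inv_apply (t : (FiniteAdeleRing (𝓞 K) K)ˣ) (v : HeightOneSpectrum (𝓞 K)) :
    ((t⁻¹ : (FiniteAdeleRing (𝓞 K) K)ˣ) : FiniteAdeleRing (𝓞 K) K) v =
      ((t : FiniteAdeleRing (𝓞 K) K) v)⁻¹ := by
  apply eq_inv_of_mul_eq_one_left
  rw [← idele_mul_apply, inv_mul_cancel]
  rfl

theorem count_ideleIdeal (t : (FiniteAdeleRing (𝓞 K) K)ˣ) (v : HeightOneSpectrum (𝓞 K)) :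
    FractionalIdeal.count K v (ideleIdeal t : FractionalIdeal (𝓞 K)⁰ K) =
      -WithZero.log (Valued.v ((t : FiniteAdeleRing (𝓞 K) K) v)) := by
  have hfin : ∀ᶠ w : HeightOneSpectrum (𝓞 K) in Filter.cofinite,
      -WithZero.log (Valued.v ((t : FiniteAdeleRing (𝓞 K) K) w)) = 0 := by
    filter_upwards [(FiniteAdeleRing.isUnit_iff.1 t.isUnit).2] with w hw
    rw [hw]
    simp
  rw [← FractionalIdeal.count_finprod K v _ hfin]
  congr 1
  rw [ideleIdeal, ← Units.coeHom_apply, MonoidHom.map_finprod]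
  · apply finprod_congr
    intro w
    simp
  · refine (Filter.eventually_cofinite.1 hfin).subset fun w hw h0 => hw ?_
    simp only [h0, zpow_zero]

theorem valued_idele (t : (FiniteAdeleRing (𝓞 K) K)ˣ) (v : HeightOneSpectrum (𝓞 K)) :
    Valued.v ((t : FiniteAdeleRing (𝓞 K) K) v) = WithZero.exp
      (-FractionalIdeal.count K v (ideleIdeal t : FractionalIdeal (𝓞 K)⁰ K)) := by
  rw [count_ideleIdeal, neg_neg, WithZero.exp_log]
  exact (Valuation.ne_zero_iff _).2 (idele_apply_ne_zero t v)

theorem ideleIdeal_mul (s t : (FiniteAdeleRing (𝓞 K) K)ˣ) :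
    ideleIdeal (s * t) = ideleIdeal s * ideleIdeal t := by
  apply fractionalIdeal_units_ext
  intro v
  rw [Units.val_mul, FractionalIdeal.count_mul K v (Units.ne_zero _) (Units.ne_zero _)]
  simp only [count_ideleIdeal, idele_mul_apply, map_mul]
  rw [WithZero.log_mul]
  · ring
  · exact (Valuation.ne_zero_iff _).2 (idele_apply_ne_zero s v)
  · exact (Valuation.ne_zero_iff _).2 (idele_apply_ne_zero t v)

variable (K) in
/-- `ideleIdeal` as a homomorphism. -/
def ideleIdealHom : (FiniteAdeleRing (𝓞 K) K)ˣ →* (FractionalIdeal (𝓞 K)⁰ K)ˣ :=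
  MonoidHom.mk' ideleIdeal ideleIdeal_mul

theorem ideleIdeal_unitEmbedding (α : Kˣ) :
    ideleIdeal (FiniteAdeleRing.unitEmbedding (𝓞 K) K α) = toPrincipalIdeal (𝓞 K) K α := by
  apply fractionalIdeal_units_ext
  intro v
  rw [count_ideleIdeal, coe_toPrincipalIdeal]
  have : ((FiniteAdeleRing.unitEmbedding (𝓞 K) K α : (FiniteAdeleRing (𝓞 K) K)ˣ) :
      FiniteAdeleRing (𝓞 K) K) v = ((α : K) : v.adicCompletion K) := rfl
  rw [this, HeightOneSpectrum.valuedAdicCompletion_eq_valuation',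
    valuation_eq_exp_neg_count v α.ne_zero, WithZero.log_exp, neg_neg]

theorem ideleIdeal_eq_one_iff (t : (FiniteAdeleRing (𝓞 K) K)ˣ) :
    ideleIdeal t = 1 ↔ t ∈ integralUnits K := by
  constructor
  · intro h v
    rw [valued_idele, h, Units.val_one, FractionalIdeal.count_one, neg_zero, WithZero.exp_zero]
  · intro h
    apply fractionalIdeal_units_ext
    intro v
    rw [count_ideleIdeal, h v, Units.val_one, FractionalIdeal.count_one]
    simp

/-- At each place an element of `K` with the required valuation is chosen. Almost all of these
valuations are trivial, so the family is an idele. -/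
theorem ideleIdeal_surjective : Function.Surjective (ideleIdealHom K) := by
  intro I
  have hex : ∀ v : HeightOneSpectrum (𝓞 K), ∃ x : K, v.valuation K x =
      WithZero.exp (-FractionalIdeal.count K v (I : FractionalIdeal (𝓞 K)⁰ K)) := fun v =>
    v.valuation_surjective K _
  choose x hx using hex
  have hx' : ∀ v : HeightOneSpectrum (𝓞 K), Valued.v ((x v : K) : v.adicCompletion K) =
      WithZero.exp (-FractionalIdeal.count K v (I : FractionalIdeal (𝓞 K)⁰ K)) := fun v => by
    rw [HeightOneSpectrum.valuedAdicCompletion_eq_valuation', hx]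
  have hone : ∀ᶠ v : HeightOneSpectrum (𝓞 K) in Filter.cofinite,
      Valued.v ((x v : K) : v.adicCompletion K) = 1 := by
    filter_upwards [FractionalIdeal.finite_factors (I : FractionalIdeal (𝓞 K)⁰ K)] with v hv
    rw [hx', hv, neg_zero, WithZero.exp_zero]
  let a : FiniteAdeleRing (𝓞 K) K := ⟨fun v => ((x v : K) : v.adicCompletion K), by
    filter_upwards [hone] with v hv using hv.le⟩
  have ha : IsUnit a := FiniteAdeleRing.isUnit_iff.2 ⟨fun v => by
    rw [← Valuation.ne_zero_iff (Valued.v : Valuation (v.adicCompletion K) _)]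
    exact (hx' v).trans_ne WithZero.exp_ne_zero, hone⟩
  refine ⟨ha.unit, fractionalIdeal_units_ext fun v => ?_⟩
  change FractionalIdeal.count K v (ideleIdeal ha.unit : FractionalIdeal (𝓞 K)⁰ K) = _
  rw [count_ideleIdeal]
  change -WithZero.log (Valued.v ((x v : K) : v.adicCompletion K)) = _
  rw [hx', WithZero.log_exp, neg_neg]

end Ideles

end CMTheta
end

noncomputable section
namespace CMTheta

/-! ### Weak approximation at the primes dividing the modulus. -/

section Approximation

variable {K : Type*} [Field K] [NumberField K]

theorem exists_valued_sub_le (v : HeightOneSpectrum (𝓞 K)) (x : v.adicCompletion K) (n : ℤ) :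
    ∃ a : K, Valued.v ((a : v.adicCompletion K) - x) ≤ WithZero.exp n := by
  obtain ⟨c, hc⟩ := v.valuation_surjective K (WithZero.exp n)
  rw [← HeightOneSpectrum.valuedAdicCompletion_eq_valuation'] at hc
  have hopen : IsOpen {y : v.adicCompletion K |
      (y - x) / (c : v.adicCompletion K) ∈ v.adicCompletionIntegers K} :=
    (Valued.isOpen_valuationSubring (v.adicCompletion K)).preimage
      ((continuous_id.sub continuous_const).div_const _)
  obtain ⟨a, ha⟩ := (HeightOneSpectrum.denseRange_algebraMap (R := 𝓞 K) K v).exists_mem_open hopen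
    ⟨x, by simp⟩
  refine ⟨a, ?_⟩
  have ha' : Valued.v (((a : v.adicCompletion K) - x) / (c : v.adicCompletion K)) ≤ 1 := ha
  rw [map_div₀, hc, div_le_one₀ (WithZero.zero_lt_coe _)] at ha'
  exact ha'

theorem finite_primes_above {m : Ideal (𝓞 K)} (hm : m ≠ ⊥) :
    {v : HeightOneSpectrum (𝓞 K) | m ≤ v.asIdeal}.Finite := by
  simpa only [Ideal.dvd_iff_le] using Ideal.finite_factors hm

/-- Weak approximation: `α` only has to be close to `t_v⁻¹` at the finitely many primes dividing
`𝔪`. This is what makes the value of `ϱ` on any idele, and the substitution `x = α⁻¹ y`, available.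
-/
theorem exists_unitEmbedding_mul_mem_coprimeIdeles {m : Ideal (𝓞 K)} (hm : m ≠ ⊥)
    (t : (FiniteAdeleRing (𝓞 K) K)ˣ) :
    ∃ α : Kˣ, FiniteAdeleRing.unitEmbedding (𝓞 K) K α * t ∈ coprimeIdeles m := by
  have hm' : (m : FractionalIdeal (𝓞 K)⁰ K) ≠ 0 := FractionalIdeal.coeIdeal_ne_zero.2 hm
  -- Multiplying `α - t_v⁻¹` by `t_v` raises the order by `ord_v(t)`, so order `ord_v(𝔪) - ord_v(t)
  -- = -c v` suffices for `α t_v ≡ 1` modulo `𝔪`.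
  set c : HeightOneSpectrum (𝓞 K) → ℤ := fun v =>
    FractionalIdeal.count K v (ideleIdeal t : FractionalIdeal (𝓞 K)⁰ K) -
      FractionalIdeal.count K v (m : FractionalIdeal (𝓞 K)⁰ K) with hc
  suffices h : ∃ α : K, ∀ v : HeightOneSpectrum (𝓞 K), m ≤ v.asIdeal →
      Valued.v ((α : v.adicCompletion K) - ((t : FiniteAdeleRing (𝓞 K) K) v)⁻¹) ≤
        WithZero.exp (c v) by
    obtain ⟨α, hα⟩ := h
    have key : ∀ v : HeightOneSpectrum (𝓞 K), m ≤ v.asIdeal →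
        Valued.v ((α : v.adicCompletion K) * (t : FiniteAdeleRing (𝓞 K) K) v - 1) ≤
          WithZero.exp (-FractionalIdeal.count K v (m : FractionalIdeal (𝓞 K)⁰ K)) := by
      intro v hv
      have h0 := idele_apply_ne_zero t v
      have e : (α : v.adicCompletion K) * (t : FiniteAdeleRing (𝓞 K) K) v - 1 =
          ((α : v.adicCompletion K) - ((t : FiniteAdeleRing (𝓞 K) K) v)⁻¹) *
            (t : FiniteAdeleRing (𝓞 K) K) v := by field_simp
      rw [e, map_mul, valued_idele]
      refine (mul_le_mul' (hα v hv) le_rfl).trans ?_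
      rw [← WithZero.exp_add, WithZero.exp_le_exp, hc]
      linarith
    -- If no prime divides `𝔪`, the approximation is vacuous and could have produced `α = 0`, so 1
    -- is taken instead.
    by_cases hS : ∃ v : HeightOneSpectrum (𝓞 K), m ≤ v.asIdeal
    · have hα0 : α ≠ 0 := by
        rintro rfl
        obtain ⟨v, hv⟩ := hS
        have h1 := key v hv
        rw [HeightOneSpectrum.adicCompletion.coe_zero, zero_mul, zero_sub, Valuation.map_neg,
          map_one, ← WithZero.exp_zero, WithZero.exp_le_exp] at h1
        have h2 : (m : FractionalIdeal (𝓞 K)⁰ K) ≤ v.asIdeal :=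
          FractionalIdeal.coeIdeal_le_coeIdeal _ |>.2 hv
        have h3 := FractionalIdeal.count_mono K v hm' h2
        rw [FractionalIdeal.count_self] at h3
        linarith
      refine ⟨Units.mk0 α hα0, fun v hv => ?_⟩
      rw [mem_localIdeal_iff v hm']
      exact key v hv
    · exact ⟨1, fun v hv => (hS ⟨v, hv⟩).elim⟩
  have hfin := finite_primes_above hm
  -- Local approximations `a v` in `K` are brought to a common denominator `d`. The Chinese
  -- remainder theorem in `𝓞 K` then glues the numerators, to a precision `N v` that allows for the
  -- later division by `d`.
  choose a ha using fun v : HeightOneSpectrum (𝓞 K) =>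
    exists_valued_sub_le v (((t : FiniteAdeleRing (𝓞 K) K) v)⁻¹) (c v)
  obtain ⟨d, hd⟩ := IsLocalization.exist_integer_multiples (𝓞 K)⁰ hfin.toFinset a
  have hd0 : algebraMap (𝓞 K) K d ≠ 0 := by simp
  choose! b hb using hd
  have he : ∀ v : HeightOneSpectrum (𝓞 K), ∃ N : ℕ,
      WithZero.exp (-(N : ℤ)) ≤ WithZero.exp (c v) * v.valuation K (algebraMap (𝓞 K) K d) := by
    intro v
    rw [valuation_eq_exp_neg_count v hd0, ← WithZero.exp_add]
    refine ⟨(-(c v + -FractionalIdeal.count K v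
      (FractionalIdeal.spanSingleton (𝓞 K)⁰ (algebraMap (𝓞 K) K d)))).toNat, ?_⟩
    rw [WithZero.exp_le_exp]
    have := Int.self_le_toNat (-(c v + -FractionalIdeal.count K v
      (FractionalIdeal.spanSingleton (𝓞 K)⁰ (algebraMap (𝓞 K) K d))))
    linarith
  choose N hN using he
  obtain ⟨y, hy⟩ := IsDedekindDomain.exists_forall_sub_mem_ideal (s := hfin.toFinset)
    (fun v : HeightOneSpectrum (𝓞 K) => v.asIdeal) N (fun v _ => v.prime)
    (fun v _ w _ hvw h => hvw (HeightOneSpectrum.ext h)) (fun v => b v)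
  refine ⟨algebraMap (𝓞 K) K y / algebraMap (𝓞 K) K d, fun v hv => ?_⟩
  have hvS : v ∈ hfin.toFinset := hfin.mem_toFinset.2 hv
  have h1 := (HeightOneSpectrum.intValuation_le_pow_iff_mem v _ _).2 (hy v hvS)
  rw [← HeightOneSpectrum.valuation_of_algebraMap (K := K)] at h1
  change v.valuation K (algebraMap (𝓞 K) K (y - b v)) ≤ _ at h1
  rw [map_sub, hb v hvS, Algebra.smul_def] at h1
  have h2 : v.valuation K (algebraMap (𝓞 K) K y / algebraMap (𝓞 K) K d - a v) ≤
      WithZero.exp (c v) := by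
    have e : algebraMap (𝓞 K) K y / algebraMap (𝓞 K) K d - a v =
      (algebraMap (𝓞 K) K y - algebraMap (𝓞 K) K d * a v) / algebraMap (𝓞 K) K d := by
      field_simp
    rw [e, map_div₀, div_le_iff₀ (zero_lt_iff.2 ((Valuation.ne_zero_iff _).2 hd0))]
    exact h1.trans (hN v)
  rw [← HeightOneSpectrum.valuedAdicCompletion_eq_valuation'] at h2
  have e : ∀ z : K, (z : v.adicCompletion K) - ((t : FiniteAdeleRing (𝓞 K) K) v)⁻¹ =
      ((z - a v : K) : v.adicCompletion K) +
        ((a v : v.adicCompletion K) - ((t : FiniteAdeleRing (𝓞 K) K) v)⁻¹) := by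
    intro z
    have : ((z - a v : K) : v.adicCompletion K) + (a v : v.adicCompletion K) = z := by
      rw [← HeightOneSpectrum.adicCompletion.coe_add, sub_add_cancel]
    rw [← this]
    ring
  rw [e]
  exact (Valuation.map_add _ _ _).trans (max_le h2 (ha v))

end Approximation

/-! ### Indices of class groups and the normalization of the volume. -/

section Index

/-- The kernel of `G/PV → G/PU` is `U/V(P ∩ U)`, and the part of `U/V` coming from `P ∩ U` is `(P ∩
U)/(V ∩ P)`. It is applied with `P = K^×`, `U` the integral ideles and `V = K_f`. -/
theorem index_sup_mul_card {G : Type*} [CommGroup G] (P : Subgroup G) {U V : Subgroup G}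
    (hVU : V ≤ U) : (P ⊔ V).index * Nat.card ↥(P ⊓ U) =
      (P ⊔ U).index * V.relIndex U * Nat.card ↥(V ⊓ P) := by
  have h1 : (P ⊔ V).relIndex U * (P ⊔ U).index = (P ⊔ V).index := by
    rw [← Subgroup.relIndex_mul_index (sup_le_sup_left hVU P)]
    congr 1
    rw [← Subgroup.relIndex_sup_left (H := U) (K := P ⊔ V), sup_assoc, sup_eq_right.2 hVU]
  have h2 : V.relIndex (P ⊓ U) * (P ⊔ V).relIndex U = V.relIndex U := by
    have e : (P ⊔ V) ⊓ U = V ⊔ P ⊓ U := by rw [sup_comm, sup_inf_assoc_of_le P hVU]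
    rw [← Subgroup.relIndex_mul_relIndex V ((P ⊔ V) ⊓ U) U (le_inf le_sup_right hVU) inf_le_right,
      Subgroup.inf_relIndex_right, e, Subgroup.relIndex_sup_left]
  have h3 : Nat.card ↥(V ⊓ P) * V.relIndex (P ⊓ U) = Nat.card ↥(P ⊓ U) := by
    have e : V ⊓ P = V ⊓ (P ⊓ U) := by
      rw [inf_comm P U, ← inf_assoc, inf_eq_left.2 hVU]
    rw [← Subgroup.inf_relIndex_right V (P ⊓ U), ← e, ← Subgroup.relIndex_bot_left,
      ← Subgroup.relIndex_bot_left]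
    exact Subgroup.relIndex_mul_relIndex _ _ _ bot_le (e.le.trans inf_le_right)
  rw [← h1, ← h2, ← h3]
  ring

variable (K : Type*) [Field K] [NumberField K]

/-- The ideal class of a finite idele. -/
def ideleClass : (FiniteAdeleRing (𝓞 K) K)ˣ →* ClassGroup (𝓞 K) :=
  (ClassGroup.mk (R := 𝓞 K) K).comp (ideleIdealHom K)

variable {K}

theorem classGroup_mk_eq_one_iff {I : (FractionalIdeal (𝓞 K)⁰ K)ˣ} :
    ClassGroup.mk K I = 1 ↔ ∃ α : Kˣ, toPrincipalIdeal (𝓞 K) K α = I := by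
  rw [ClassGroup.mk_eq_one_iff, FractionalIdeal.isPrincipal_iff]
  constructor
  · rintro ⟨x, hx⟩
    have hx0 : x ≠ 0 := by
      rintro rfl
      rw [FractionalIdeal.spanSingleton_zero] at hx
      exact I.ne_zero hx
    exact ⟨Units.mk0 x hx0, Units.ext (by rw [coe_toPrincipalIdeal, hx]; rfl)⟩
  · rintro ⟨α, rfl⟩
    exact ⟨α, coe_toPrincipalIdeal α⟩

theorem classGroup_mk_surjective : Function.Surjective (ClassGroup.mk (R := 𝓞 K) K) := by
  intro c
  obtain ⟨I, rfl⟩ := ClassGroup.mk0_surjective c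
  exact ⟨_, ClassGroup.mk_mk0 K I⟩

theorem ideleClass_surjective : Function.Surjective (ideleClass K) :=
  classGroup_mk_surjective.comp ideleIdeal_surjective

theorem ideleClass_unitEmbedding (α : Kˣ) :
    ideleClass K (FiniteAdeleRing.unitEmbedding (𝓞 K) K α) = 1 :=
  classGroup_mk_eq_one_iff.2 ⟨α, (ideleIdeal_unitEmbedding α).symm⟩

theorem ideleClass_eq_one_of_mem {u : (FiniteAdeleRing (𝓞 K) K)ˣ} (hu : u ∈ integralUnits K) :
    ideleClass K u = 1 := by
  change ClassGroup.mk K (ideleIdeal u) = 1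
  rw [(ideleIdeal_eq_one_iff u).2 hu, map_one]

/-- Dividing an idele with principal ideal by a generator leaves an idele that is a unit at every
place. -/
theorem ker_ideleClass : (ideleClass K).ker =
    (FiniteAdeleRing.unitEmbedding (𝓞 K) K).range ⊔ integralUnits K := by
  apply le_antisymm
  · intro t ht
    obtain ⟨α, hα⟩ := classGroup_mk_eq_one_iff.1 ht
    rw [← ideleIdeal_unitEmbedding] at hα
    refine Subgroup.mem_sup.2 ⟨_, ⟨α, rfl⟩, (FiniteAdeleRing.unitEmbedding (𝓞 K) K α)⁻¹ * t, ?_,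
      mul_inv_cancel_left _ _⟩
    rw [← ideleIdeal_eq_one_iff]
    change ideleIdealHom K _ = 1
    rw [map_mul, map_inv, inv_mul_eq_one]
    exact hα
  · refine sup_le ?_ fun u hu => ideleClass_eq_one_of_mem hu
    rintro _ ⟨α, rfl⟩
    exact ideleClass_unitEmbedding α

theorem unitEmbedding_range_inf_integralUnits :
    (FiniteAdeleRing.unitEmbedding (𝓞 K) K).range ⊓ integralUnits K =
      (Units.map (algebraMap (𝓞 K) (FiniteAdeleRing (𝓞 K) K) : 𝓞 K →* _)).range := by
  have hmap : ∀ u : (𝓞 K)ˣ,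
      Units.map (algebraMap (𝓞 K) (FiniteAdeleRing (𝓞 K) K) : 𝓞 K →* _) u =
        FiniteAdeleRing.unitEmbedding (𝓞 K) K (Units.map (algebraMap (𝓞 K) K : 𝓞 K →* K) u) :=
    fun u => Units.ext rfl
  apply le_antisymm
  · rintro _ ⟨⟨α, rfl⟩, hα⟩
    have h1 : ∀ β : Kˣ, FiniteAdeleRing.unitEmbedding (𝓞 K) K β ∈ integralUnits K →
        ∃ y : 𝓞 K, algebraMap (𝓞 K) K y = β := by
      intro β hβ
      apply HeightOneSpectrum.mem_integers_of_valuation_le_one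
      intro v
      rw [← HeightOneSpectrum.valuedAdicCompletion_eq_valuation']
      exact (hβ v).le
    obtain ⟨y, hy⟩ := h1 α hα
    obtain ⟨z, hz⟩ := h1 α⁻¹ (by rw [map_inv]; exact inv_mem hα)
    have hyz : y * z = 1 := by
      apply FaithfulSMul.algebraMap_injective (𝓞 K) K
      rw [map_mul, hy, hz, map_one, Units.mul_inv]
    refine ⟨⟨y, z, hyz, by rw [mul_comm, hyz]⟩, ?_⟩
    rw [hmap]
    congr 1
    exact Units.ext hy
  · rintro _ ⟨u, rfl⟩
    refine ⟨⟨_, (hmap u).symm⟩, ?_⟩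
    apply (ideleIdeal_eq_one_iff _).1
    rw [hmap, ideleIdeal_unitEmbedding]
    apply Units.ext
    rw [coe_toPrincipalIdeal, Units.val_one]
    change FractionalIdeal.spanSingleton (𝓞 K)⁰ (algebraMap (𝓞 K) K u) = 1
    rw [← FractionalIdeal.coeIdeal_span_singleton, Ideal.span_singleton_eq_top.2 u.isUnit,
      FractionalIdeal.coeIdeal_top]

variable (K) in
-- One prime suffices, because `K` embeds in each completion; a prime exists because `𝓞 K` is not a
-- field.
theorem algebraMap_finiteAdeleRing_injective :
    Function.Injective (algebraMap (𝓞 K) (FiniteAdeleRing (𝓞 K) K)) := by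
  obtain ⟨p, hp, hprime⟩ := Ring.not_isField_iff_exists_prime.1 (RingOfIntegers.not_isField K)
  let v : HeightOneSpectrum (𝓞 K) := ⟨p, hprime, hp⟩
  intro x y hxy
  have h : (algebraMap (𝓞 K) K x : v.adicCompletion K) = algebraMap (𝓞 K) K y :=
    congrArg (fun z : FiniteAdeleRing (𝓞 K) K => z v) hxy
  exact FaithfulSMul.algebraMap_injective (𝓞 K) K
    ((algebraMap K (v.adicCompletion K)).injective h)

variable (K) in
/-- The subgroup `O_K^×` of the finite ideles. -/
def globalUnits : Subgroup (FiniteAdeleRing (𝓞 K) K)ˣ :=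
  (Units.map (algebraMap (𝓞 K) (FiniteAdeleRing (𝓞 K) K) : 𝓞 K →* _)).range

variable (K) in
/-- The units of `𝓞 K` are the elements of `globalUnits K`. -/
def globalUnitsEquiv : (𝓞 K)ˣ ≃* globalUnits K :=
  MonoidHom.ofInjective (f := Units.map (algebraMap (𝓞 K) (FiniteAdeleRing (𝓞 K) K) :
    𝓞 K →* FiniteAdeleRing (𝓞 K) K))
    fun _ _ h => Units.ext (algebraMap_finiteAdeleRing_injective K (congrArg Units.val h))

theorem index_mul_card_units {Kf : Subgroup (FiniteAdeleRing (𝓞 K) K)ˣ}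
    (hle : Kf ≤ integralUnits K) :
    Nat.card (IdeleClassGroup Kf) * Nat.card (𝓞 K)ˣ =
      Nat.card (ClassGroup (𝓞 K)) * Kf.relIndex (integralUnits K) *
        Nat.card ↥(Kf ⊓ globalUnits K) := by
  have key := index_sup_mul_card (FiniteAdeleRing.unitEmbedding (𝓞 K) K).range hle
  have hinf : Kf ⊓ (FiniteAdeleRing.unitEmbedding (𝓞 K) K).range = Kf ⊓ globalUnits K := by
    rw [globalUnits, ← unitEmbedding_range_inf_integralUnits, inf_comm _ (integralUnits K),
      ← inf_assoc, inf_eq_left.2 hle]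
  rw [hinf, unitEmbedding_range_inf_integralUnits, ← ker_ideleClass, Subgroup.index_ker,
    MonoidHom.range_eq_top.2 ideleClass_surjective, Subgroup.card_top] at key
  rw [← key, Nat.card_congr (globalUnitsEquiv K).toEquiv]
  rfl

/-- The volume exactly compensates the growth of `Cl(K_f)` as `K_f` shrinks, so that volume times
number of classes is independent of the level. -/
theorem vol_mul_index {Kf : Subgroup (FiniteAdeleRing (𝓞 K) K)ˣ} [Finite (𝓞 K)ˣ]
    (hle : Kf ≤ integralUnits K) (hfin : Kf.relIndex (integralUnits K) ≠ 0) :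
    vol Kf * Nat.card (IdeleClassGroup Kf) = Nat.card (ClassGroup (𝓞 K)) := by
  have key := congrArg (Nat.cast : ℕ → ℂ) (index_mul_card_units hle)
  have : Finite (globalUnits K) := Finite.of_equiv _ (globalUnitsEquiv K).toEquiv
  have hE : Finite ↥(Kf ⊓ globalUnits K) :=
    Finite.of_injective _ (Subgroup.inclusion_injective (inf_le_right (a := Kf)))
  have h2 := (Nat.cast_ne_zero (R := ℂ)).2 (Nat.card_pos (α := ↥(Kf ⊓ globalUnits K))).ne'
  have h1 := (Nat.cast_ne_zero (R := ℂ)).2 hfin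
  push_cast at key
  have hv : vol Kf = ((Kf.relIndex (integralUnits K) : ℂ))⁻¹ * (Nat.card (𝓞 K)ˣ : ℂ) *
    (Nat.card ↥(Kf ⊓ globalUnits K) : ℂ)⁻¹ := rfl
  rw [hv]
  generalize (Nat.card ↥(Kf ⊓ globalUnits K) : ℂ) = a at *
  generalize (Kf.relIndex (integralUnits K) : ℂ) = b at *
  generalize (Nat.card (IdeleClassGroup Kf) : ℂ) = c at *
  field_simp
  linear_combination key

end Index

end CMTheta
end

noncomputable section
namespace CMTheta

/-! ### Galois action on ideles, norms, and finiteness of the unit group. -/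

section Conjugation

variable {K : Type*} [Field K] [NumberField K]

theorem absNorm_primeComap (e : K ≃+* K) (w : HeightOneSpectrum (𝓞 K)) :
    Ideal.absNorm (primeComap e w).asIdeal = Ideal.absNorm w.asIdeal := by
  rw [Ideal.absNorm_apply, Ideal.absNorm_apply, Submodule.cardQuot_apply, Submodule.cardQuot_apply]
  refine Nat.card_congr (Ideal.quotientEquiv (primeComap e w).asIdeal w.asIdeal
    (RingOfIntegers.mapRingEquiv e) ?_).toEquiv
  exact (Ideal.map_comap_of_surjective _ (RingOfIntegers.mapRingEquiv e).surjective _).symm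

theorem absNorm_ideleIdeal (t : (FiniteAdeleRing (𝓞 K) K)ˣ) :
    FractionalIdeal.absNorm (ideleIdeal t : FractionalIdeal (𝓞 K)⁰ K) =
      ∏ᶠ v : HeightOneSpectrum (𝓞 K), (Ideal.absNorm v.asIdeal : ℚ) ^
        (-WithZero.log (Valued.v ((t : FiniteAdeleRing (𝓞 K) K) v))) := by
  have hfin : ∀ᶠ w : HeightOneSpectrum (𝓞 K) in Filter.cofinite,
      -WithZero.log (Valued.v ((t : FiniteAdeleRing (𝓞 K) K) w)) = 0 := by
    filter_upwards [(FiniteAdeleRing.isUnit_iff.1 t.isUnit).2] with w hw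
    rw [hw]
    simp
  let N : (FractionalIdeal (𝓞 K)⁰ K)ˣ →* ℚ :=
    (FractionalIdeal.absNorm (K := K) (R := 𝓞 K) : _ →* ℚ).comp (Units.coeHom _)
  change N (ideleIdeal t) = _
  rw [ideleIdeal, MonoidHom.map_finprod]
  · apply finprod_congr
    intro v
    simp [N, FractionalIdeal.coeIdeal_absNorm]
  · refine (Filter.eventually_cofinite.1 hfin).subset fun w hw h0 => hw ?_
    simp only [h0, zpow_zero]

/-- The map preserves integrality; applying this to `x` and to `x⁻¹` bounds the valuation from both
sides. -/
theorem completionMap_valued_eq_one (e : K ≃+* K) (w : HeightOneSpectrum (𝓞 K))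
    {x : (primeComap e w).adicCompletion K} (hx : Valued.v x = 1) :
    Valued.v (completionMap e w x) = 1 := by
  have h0 : x ≠ 0 := by
    rintro rfl
    simp at hx
  have h1 : Valued.v (completionMap e w x) ≤ 1 := completionMap_mapsTo e w hx.le
  have h2 : Valued.v (completionMap e w x⁻¹) ≤ 1 := completionMap_mapsTo e w (by
    change Valued.v x⁻¹ ≤ 1
    rw [map_inv₀, hx, inv_one])
  refine le_antisymm h1 ?_
  rw [map_inv₀, map_inv₀] at h2
  have h3 : Valued.v (completionMap e w x) ≠ 0 :=
    (Valuation.ne_zero_iff _).2 ((map_ne_zero _).2 h0)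
  exact (inv_le_one₀ (zero_lt_iff.2 h3)).1 h2

/-- Dividing by an element of `K` with the same valuation reduces to local units, and for elements
of `K` the claim is `valuation_primeComap`. -/
theorem completionMap_valued (e : K ≃+* K) (w : HeightOneSpectrum (𝓞 K))
    (x : (primeComap e w).adicCompletion K) :
    Valued.v (completionMap e w x) = Valued.v x := by
  rcases eq_or_ne x 0 with rfl | hx
  · simp
  obtain ⟨a, ha⟩ := (primeComap e w).valuation_surjective K (Valued.v x)
  rw [← HeightOneSpectrum.valuedAdicCompletion_eq_valuation'] at ha
  have hvx : Valued.v x ≠ 0 := (Valuation.ne_zero_iff _).2 hx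
  have ha0 : (a : (primeComap e w).adicCompletion K) ≠ 0 := by
    rw [← Valuation.ne_zero_iff (Valued.v : Valuation ((primeComap e w).adicCompletion K) _), ha]
    exact hvx
  have h1 := completionMap_valued_eq_one e w (x := x / (a : (primeComap e w).adicCompletion K))
    (by rw [map_div₀, ha, div_self hvx])
  rw [map_div₀, map_div₀, completionMap_coe, HeightOneSpectrum.valuedAdicCompletion_eq_valuation',
    ← valuation_primeComap, ← HeightOneSpectrum.valuedAdicCompletion_eq_valuation', ha] at h1
  exact (div_eq_one_iff_eq hvx).1 h1

/-- The automorphism permutes the primes and preserves their norms, so the product over the primes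
is only reindexed. -/
theorem absNorm_ideleIdeal_map (e : K ≃+* K) (t : (FiniteAdeleRing (𝓞 K) K)ˣ) :
    FractionalIdeal.absNorm (ideleIdeal (Units.map
      (adeleMap e : FiniteAdeleRing (𝓞 K) K →* FiniteAdeleRing (𝓞 K) K) t) :
        FractionalIdeal (𝓞 K)⁰ K) =
      FractionalIdeal.absNorm (ideleIdeal t : FractionalIdeal (𝓞 K)⁰ K) := by
  rw [absNorm_ideleIdeal, absNorm_ideleIdeal]
  refine Eq.trans ?_ (finprod_comp_equiv
    (HeightOneSpectrum.equivOfRingEquiv (RingOfIntegers.mapRingEquiv e)).symm)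
  apply finprod_congr
  intro w
  change _ = (Ideal.absNorm (primeComap e w).asIdeal : ℚ) ^
    (-WithZero.log (Valued.v ((t : FiniteAdeleRing (𝓞 K) K) (primeComap e w))))
  rw [absNorm_primeComap, ← completionMap_valued e w]
  rfl

variable [Algebra.IsQuadraticExtension ℚ K] [IsTotallyComplex K]

/-- The ideals of `h` and `h̄` have equal norm. This is why the twist by `h̄/h` leaves the exponents
of `q` compatible with norms of ideals. -/
theorem absNorm_ideleIdeal_normMinus (t : (FiniteAdeleRing (𝓞 K) K)ˣ) :
    FractionalIdeal.absNorm (ideleIdeal (normMinus K t) : FractionalIdeal (𝓞 K)⁰ K) = 1 := by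
  have h : normMinus K t * Units.map (adeleMap (conj K) : FiniteAdeleRing (𝓞 K) K →* _) t = t :=
    div_mul_cancel _ _
  have h1 := congrArg (fun s => FractionalIdeal.absNorm
    (ideleIdeal s : FractionalIdeal (𝓞 K)⁰ K)) h
  simp only [ideleIdeal_mul, Units.val_mul, map_mul, absNorm_ideleIdeal_map] at h1
  refine mul_right_cancel₀ ?_ (h1.trans (one_mul _).symm)
  rw [Ne, FractionalIdeal.absNorm_eq_zero_iff]
  exact Units.ne_zero _

theorem normMinus_unitEmbedding (α : Kˣ) :
    ideleClass K (normMinus K (FiniteAdeleRing.unitEmbedding (𝓞 K) K α)) = 1 := by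
  have h : Units.map (adeleMap (conj K) : FiniteAdeleRing (𝓞 K) K →* _)
      (FiniteAdeleRing.unitEmbedding (𝓞 K) K α) =
        FiniteAdeleRing.unitEmbedding (𝓞 K) K (Units.map (conj K : K →* K) α) :=
    Units.ext (adeleMap_algebraMap (conj K) α)
  change ideleClass K (_ / _) = 1
  rw [h, map_div, ideleClass_unitEmbedding, MonoidHom.id_apply, ideleClass_unitEmbedding, div_one]

theorem normMinus_mem_integralUnits {u : (FiniteAdeleRing (𝓞 K) K)ˣ} (hu : u ∈ integralUnits K) :
    normMinus K u ∈ integralUnits K := by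
  refine div_mem hu fun w => ?_
  exact (completionMap_valued (conj K) w _).trans (hu _)

theorem norm_eq_norm_sq (σ : K →+* ℂ) (x : K) :
    ((Algebra.norm ℚ x : ℚ) : ℝ) = ‖σ x‖ ^ 2 := by
  classical
  have hne : (σ : K →+* ℂ) ≠ ComplexEmbedding.conjugate σ := fun h =>
    IsTotallyComplex.complexEmbedding_not_isReal σ h.symm
  have huniv : ({σ, ComplexEmbedding.conjugate σ} : Finset (K →+* ℂ)) = Finset.univ := by
    apply Finset.eq_univ_of_card
    rw [Finset.card_pair hne, Embeddings.card, Algebra.IsQuadraticExtension.finrank_eq_two]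
  have h := Algebra.norm_eq_prod_embeddings ℚ ℂ x
  rw [← Fintype.prod_equiv (RingHom.equivRatAlgHom K ℂ) (fun f => f x)
    (fun φ => φ x) fun _ => by simp [RingHom.equivRatAlgHom_apply], ← huniv,
    Finset.prod_pair hne, ComplexEmbedding.conjugate_coe_eq, Complex.mul_conj,
    Complex.normSq_eq_norm_sq] at h
  rw [eq_ratCast] at h
  exact_mod_cast h

theorem algebraNorm_nonneg (x : K) : 0 ≤ Algebra.norm ℚ x := by
  have h := norm_eq_norm_sq (Classical.arbitrary (K →+* ℂ)) x
  exact_mod_cast h ▸ sq_nonneg ‖(Classical.arbitrary (K →+* ℂ)) x‖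

variable (K) in
-- A unit has norm 1, hence absolute value 1 in every embedding, and there are only finitely many
-- such integers.
theorem finite_units : Finite (𝓞 K)ˣ := by
  have hmem : ∀ u : (𝓞 K)ˣ, (u : K) ∈ {x : K | IsIntegral ℤ x ∧ ∀ φ : K →+* ℂ, ‖φ x‖ ≤ 1} := by
    intro u
    refine ⟨RingOfIntegers.isIntegral_coe _, fun φ => ?_⟩
    have h := norm_eq_norm_sq φ (u : K)
    have h1 : |Algebra.norm ℚ (u : K)| = 1 := by
      exact isUnit_iff_norm.1 u.isUnit
    rw [abs_of_nonneg (algebraNorm_nonneg _)] at h1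
    rw [h1] at h
    push_cast at h
    nlinarith [norm_nonneg (φ (u : K))]
  have hfin : Finite {x : K | IsIntegral ℤ x ∧ ∀ φ : K →+* ℂ, ‖φ x‖ ≤ 1} :=
    Embeddings.finite_of_norm_le K ℂ 1
  refine Finite.of_injective (fun u => (⟨u, hmem u⟩ :
    {x : K | IsIntegral ℤ x ∧ ∀ φ : K →+* ℂ, ‖φ x‖ ≤ 1})) fun u v h => ?_
  have h' : (u : K) = (v : K) := Subtype.mk.inj h
  exact Units.ext (RingOfIntegers.ext h')

end Conjugation

end CMTheta
end

noncomputable section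
namespace CMTheta

/-! ### Convergence of Gaussian sums over fractional ideals. -/

section Lattice

/-- A single term of the exponential series bounds `(c r²)^M / M!` by `exp (c r²)`, and `r^M ≤ 1 +
r^{2M}` handles small `r` and odd `M`. -/
theorem pow_mul_exp_neg_mul_sq_le (M : ℕ) (r : ℝ) {c : ℝ} (hc : 0 < c) :
    r ^ M * Real.exp (-(c * r ^ 2)) ≤ 1 + M.factorial / c ^ M := by
  have h1 : r ^ M ≤ 1 + (r ^ 2) ^ M := by
    rw [← pow_mul, mul_comm, pow_mul]
    nlinarith [sq_nonneg (r ^ M - 1)]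
  have h2 : (c * r ^ 2) ^ M / M.factorial ≤ Real.exp (c * r ^ 2) :=
    Real.pow_div_factorial_le_exp _ (by positivity) M
  have hM : (0 : ℝ) < M.factorial := by exact_mod_cast M.factorial_pos
  have h3 : (r ^ 2) ^ M ≤ M.factorial / c ^ M * Real.exp (c * r ^ 2) := by
    rw [mul_pow, div_le_iff₀ hM] at h2
    rw [div_mul_eq_mul_div, le_div_iff₀ (by positivity)]
    linarith
  have h4 : (1 : ℝ) ≤ Real.exp (c * r ^ 2) := Real.one_le_exp (by positivity)
  rw [Real.exp_neg, ← div_eq_mul_inv, div_le_iff₀ (Real.exp_pos _)]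
  nlinarith

variable {K : Type*} [Field K] [NumberField K] [Algebra.IsQuadraticExtension ℚ K]
  [IsTotallyComplex K]

/-- The field norm is the square of the absolute value at any embedding, so all infinite places
coincide and the lattice norm used below is simply `‖σ x‖`. -/
theorem infinitePlace_apply_eq (σ : K →+* ℂ) (w : InfinitePlace K) (x : K) : w x = ‖σ x‖ := by
  have h := norm_eq_norm_sq σ x
  rw [norm_eq_norm_sq w.embedding x, InfinitePlace.norm_embedding_eq] at h
  exact (pow_left_inj₀ (apply_nonneg w x) (norm_nonneg _) two_ne_zero).1 h

open scoped Classical in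
theorem norm_mixedEmbedding (σ : K →+* ℂ) (x : K) : ‖mixedEmbedding K x‖ = ‖σ x‖ := by
  rw [mixedEmbedding.norm_eq_sup'_normAtPlace]
  simp only [mixedEmbedding.normAtPlace_apply, infinitePlace_apply_eq σ, Finset.sup'_const]

open scoped Classical in
theorem summable_fractionalIdeal (σ : K →+* ℂ) (I : (FractionalIdeal (𝓞 K)⁰ K)ˣ) (p : ℕ) {c : ℝ}
    (hc : 0 < c) : Summable fun x : {x : K // x ∈ (I : FractionalIdeal (𝓞 K)⁰ K)} =>
      ‖σ x‖ ^ p * Real.exp (-(c * ‖σ x‖ ^ 2)) := by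
  -- An exponent larger than the rank makes the sum of `‖x‖^{-n}` over the lattice converge, and the
  -- Gaussian dominates this sum.
  set n := Module.finrank ℤ (mixedEmbedding.idealLattice K I) + 1 with hn
  have h1 := ZLattice.summable_norm_pow_inv (L := mixedEmbedding.idealLattice K I) n
    (Nat.lt_succ_self _)
  let f : {x : K // x ∈ (I : FractionalIdeal (𝓞 K)⁰ K)} → mixedEmbedding.idealLattice K I :=
    fun x => ⟨mixedEmbedding K x, (mixedEmbedding.mem_idealLattice K I).2 ⟨x, x.2, rfl⟩⟩
  have hf : Function.Injective f := fun x y h =>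
    Subtype.ext (mixedEmbedding_injective K (Subtype.ext_iff.1 h))
  have h2 := (h1.comp_injective hf).mul_left (1 + ((p + n).factorial : ℝ) / c ^ (p + n))
  refine h2.of_norm_bounded_eventually ?_
  -- The origin is the one exception: there the comparison term is 0 by `0⁻¹ = 0`, while the
  -- Gaussian term is 1 when `p = 0`.
  refine (Set.finite_singleton
    (⟨0, (I : FractionalIdeal (𝓞 K)⁰ K).zero_mem⟩ : {x : K // _})).subset fun x hx => ?_
  by_contra hx0
  refine hx ?_
  have hx1 : (x : K) ≠ 0 := fun h => hx0 (Subtype.ext h)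
  have hpos : 0 < ‖σ x‖ := norm_pos_iff.2 ((map_ne_zero σ).2 hx1)
  have h3 := pow_mul_exp_neg_mul_sq_le (p + n) ‖σ x‖ hc
  have h4 : ‖((f x : mixedEmbedding.idealLattice K I) : mixedEmbedding.mixedSpace K)‖ = ‖σ x‖ :=
    norm_mixedEmbedding σ x
  change ‖‖σ x‖ ^ p * Real.exp (-(c * ‖σ x‖ ^ 2))‖ ≤
    (1 + ((p + n).factorial : ℝ) / c ^ (p + n)) *
      (‖((f x : mixedEmbedding.idealLattice K I) : mixedEmbedding.mixedSpace K)‖⁻¹ ^ n)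
  rw [h4, inv_pow, Real.norm_of_nonneg (by positivity), ← div_eq_mul_inv, le_div_iff₀ (by positivity)]
  calc _ = ‖σ x‖ ^ (p + n) * Real.exp (-(c * ‖σ x‖ ^ 2)) := by ring
    _ ≤ _ := h3

end Lattice

end CMTheta
end

noncomputable section
namespace CMTheta

/-! ### The Hecke character on ideals, ideles and principal ideals. -/

section Character

variable {K : Type*} [Field K] [NumberField K] {m : Ideal (𝓞 K)}

theorem count_pos_of_le {v : HeightOneSpectrum (𝓞 K)} (hm : m ≠ ⊥) (hv : m ≤ v.asIdeal) :
    0 < FractionalIdeal.count K v (m : FractionalIdeal (𝓞 K)⁰ K) := by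
  have h := FractionalIdeal.count_mono K v (FractionalIdeal.coeIdeal_ne_zero.2 hm)
    ((FractionalIdeal.coeIdeal_le_coeIdeal K).2 hv)
  rw [FractionalIdeal.count_self] at h
  exact h

theorem count_eq_zero_of_not_le {v : HeightOneSpectrum (𝓞 K)} (hm : m ≠ ⊥)
    (hv : ¬ m ≤ v.asIdeal) : FractionalIdeal.count K v (m : FractionalIdeal (𝓞 K)⁰ K) = 0 := by
  classical
  rw [FractionalIdeal.count_coe K v hm, Nat.cast_eq_zero]
  by_contra h
  exact hv (Ideal.dvd_iff_le.1 ((Associates.count_ne_zero_iff_dvd hm v.irreducible).1 h))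

theorem exp_neg_count_lt_one {v : HeightOneSpectrum (𝓞 K)} (hm : m ≠ ⊥) (hv : m ≤ v.asIdeal) :
    WithZero.exp (-FractionalIdeal.count K v (m : FractionalIdeal (𝓞 K)⁰ K)) < 1 := by
  rw [← WithZero.exp_zero, WithZero.exp_lt_exp]
  linarith [count_pos_of_le hm hv]

theorem mem_coprimeIdeles_iff (hm : m ≠ ⊥) (t : (FiniteAdeleRing (𝓞 K) K)ˣ) :
    t ∈ coprimeIdeles m ↔ ∀ v : HeightOneSpectrum (𝓞 K), m ≤ v.asIdeal →
      Valued.v ((t : FiniteAdeleRing (𝓞 K) K) v - 1) ≤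
        WithZero.exp (-FractionalIdeal.count K v (m : FractionalIdeal (𝓞 K)⁰ K)) := by
  have hm' : (m : FractionalIdeal (𝓞 K)⁰ K) ≠ 0 := FractionalIdeal.coeIdeal_ne_zero.2 hm
  refine forall₂_congr fun v _ => mem_localIdeal_iff v hm' _

theorem valued_eq_one_of_mem_coprimeIdeles (hm : m ≠ ⊥) {t : (FiniteAdeleRing (𝓞 K) K)ˣ}
    (ht : t ∈ coprimeIdeles m) {v : HeightOneSpectrum (𝓞 K)} (hv : m ≤ v.asIdeal) :
    Valued.v ((t : FiniteAdeleRing (𝓞 K) K) v) = 1 := by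
  have h := ((mem_coprimeIdeles_iff hm t).1 ht v hv).trans_lt (exp_neg_count_lt_one hm hv)
  have h1 := Valuation.map_one_add_of_lt _ h
  rwa [add_sub_cancel] at h1

theorem ideleIdeal_mem_coprimeIdeals (hm : m ≠ ⊥) {t : (FiniteAdeleRing (𝓞 K) K)ˣ}
    (ht : t ∈ coprimeIdeles m) : ideleIdeal t ∈ coprimeIdeals m := by
  intro v hv
  rw [count_ideleIdeal, valued_eq_one_of_mem_coprimeIdeles hm ht hv]
  simp

theorem mul_inv_mem_coprimeIdeles (hm : m ≠ ⊥) {s t : (FiniteAdeleRing (𝓞 K) K)ˣ}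
    (hs : s ∈ coprimeIdeles m) (ht : t ∈ coprimeIdeles m) : s * t⁻¹ ∈ coprimeIdeles m := by
  rw [mem_coprimeIdeles_iff hm] at *
  intro v hv
  have h1 := valued_eq_one_of_mem_coprimeIdeles hm ((mem_coprimeIdeles_iff hm t).2 ht) hv
  have h0 := idele_apply_ne_zero t v
  rw [idele_mul_apply, idele_inv_apply]
  have e : (s : FiniteAdeleRing (𝓞 K) K) v * ((t : FiniteAdeleRing (𝓞 K) K) v)⁻¹ - 1 =
    (((s : FiniteAdeleRing (𝓞 K) K) v - 1) - ((t : FiniteAdeleRing (𝓞 K) K) v - 1)) /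
      (t : FiniteAdeleRing (𝓞 K) K) v := by field_simp; ring
  rw [e, map_div₀, h1, div_one]
  exact (Valuation.map_sub _ _ _).trans (max_le (hs v hv) (ht v hv))

theorem one_mem_coprimeIdeles (hm : m ≠ ⊥) :
    (1 : (FiniteAdeleRing (𝓞 K) K)ˣ) ∈ coprimeIdeles m := by
  rw [mem_coprimeIdeles_iff hm]
  intro v _
  have : ((1 : (FiniteAdeleRing (𝓞 K) K)ˣ) : FiniteAdeleRing (𝓞 K) K) v = 1 := rfl
  rw [this, sub_self, map_zero]
  exact zero_le

theorem mul_mem_coprimeIdeles (hm : m ≠ ⊥) {s t : (FiniteAdeleRing (𝓞 K) K)ˣ}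
    (hs : s ∈ coprimeIdeles m) (ht : t ∈ coprimeIdeles m) : s * t ∈ coprimeIdeles m := by
  have := mul_inv_mem_coprimeIdeles hm hs
    (mul_inv_mem_coprimeIdeles hm (one_mem_coprimeIdeles hm) ht)
  rwa [one_mul, inv_inv] at this

variable {σ : K →+* ℂ} {k : ℕ} (ϱ : HeckeCharacter σ k m)

theorem onIdeal_ne_zero {I : (FractionalIdeal (𝓞 K)⁰ K)ˣ} (hI : I ∈ coprimeIdeals m) :
    ϱ.onIdeal I ≠ 0 := by
  rw [HeckeCharacter.onIdeal, dif_pos hI]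
  exact Units.ne_zero _

theorem onIdeal_mul {I : (FractionalIdeal (𝓞 K)⁰ K)ˣ} (hI : I ∈ coprimeIdeals m)
    (J : (FractionalIdeal (𝓞 K)⁰ K)ˣ) : ϱ.onIdeal (I * J) = ϱ.onIdeal I * ϱ.onIdeal J := by
  by_cases hJ : J ∈ coprimeIdeals m
  · rw [HeckeCharacter.onIdeal, HeckeCharacter.onIdeal, HeckeCharacter.onIdeal, dif_pos hI,
      dif_pos hJ, dif_pos (mul_mem hI hJ), ← Units.val_mul, ← map_mul]
    rfl
  · have hIJ : I * J ∉ coprimeIdeals m := fun h => hJ ((Subgroup.mul_mem_cancel_left _ hI).1 h)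
    rw [HeckeCharacter.onIdeal, HeckeCharacter.onIdeal, HeckeCharacter.onIdeal, dif_neg hJ,
      dif_neg hIJ, mul_zero]

theorem onIdeal_inv_mul {I : (FractionalIdeal (𝓞 K)⁰ K)ˣ} (hI : I ∈ coprimeIdeals m)
    (J : (FractionalIdeal (𝓞 K)⁰ K)ˣ) : ϱ.onIdeal (J * I⁻¹) = (ϱ.onIdeal I)⁻¹ * ϱ.onIdeal J := by
  rw [eq_inv_mul_iff_mul_eq₀ (onIdeal_ne_zero ϱ hI), ← onIdeal_mul ϱ hI, mul_comm J,
    mul_inv_cancel_left]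

theorem onIdeal_toPrincipalIdeal (hm : m ≠ ⊥) {α : Kˣ}
    (hα : FiniteAdeleRing.unitEmbedding (𝓞 K) K α ∈ coprimeIdeles m) :
    ϱ.onIdeal (toPrincipalIdeal (𝓞 K) K α) = σ α ^ (k - 1) := by
  have h := ideleIdeal_mem_coprimeIdeals hm hα
  rw [ideleIdeal_unitEmbedding] at h
  rw [HeckeCharacter.onIdeal, dif_pos h]
  exact ϱ.map_principal α h hα

/-- Two admissible choices differ by an element `β/α ≡ 1` modulo `𝔪`, on whose ideal `ϱ` takes the
value `(β/α)^{k-1}`. Hence the chosen witness in `onIdele` may be replaced by any other. -/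
theorem onIdele_eq (hm : m ≠ ⊥) {t : (FiniteAdeleRing (𝓞 K) K)ˣ} {α : Kˣ}
    (hα : FiniteAdeleRing.unitEmbedding (𝓞 K) K α * t ∈ coprimeIdeles m) :
    ϱ.onIdele t = (σ α ^ (k - 1))⁻¹ *
      ϱ.onIdeal (ideleIdeal (FiniteAdeleRing.unitEmbedding (𝓞 K) K α * t)) := by
  have H : ∃ α : Kˣ, FiniteAdeleRing.unitEmbedding (𝓞 K) K α * t ∈ coprimeIdeles m := ⟨α, hα⟩
  rw [HeckeCharacter.onIdele, dif_pos H]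
  have hβ := H.choose_spec
  set β := H.choose
  have h1 : FiniteAdeleRing.unitEmbedding (𝓞 K) K (β * α⁻¹) ∈ coprimeIdeles m := by
    have := mul_inv_mem_coprimeIdeles hm hβ hα
    rwa [mul_inv, mul_mul_mul_comm, mul_inv_cancel, mul_one, ← map_inv, ← map_mul] at this
  have h2 : ideleIdeal (FiniteAdeleRing.unitEmbedding (𝓞 K) K β * t) =
      ideleIdeal (FiniteAdeleRing.unitEmbedding (𝓞 K) K α * t) *
        toPrincipalIdeal (𝓞 K) K (β * α⁻¹) := by
    rw [← ideleIdeal_unitEmbedding, ← ideleIdeal_mul]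
    congr 1
    rw [map_mul, map_inv, eq_comm, mul_comm, mul_assoc, inv_mul_cancel_left]
  rw [h2, onIdeal_mul ϱ (ideleIdeal_mem_coprimeIdeals hm hα), onIdeal_toPrincipalIdeal ϱ hm h1]
  have hα0 : σ α ≠ 0 := (map_ne_zero σ).2 α.ne_zero
  have hβ0 : σ β ≠ 0 := (map_ne_zero σ).2 β.ne_zero
  rw [Units.val_mul, map_mul, mul_pow, Units.val_inv_eq_inv_val, map_inv₀,
    inv_pow]
  field_simp

theorem onIdele_of_mem (hm : m ≠ ⊥) {t : (FiniteAdeleRing (𝓞 K) K)ˣ}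
    (ht : t ∈ coprimeIdeles m) : ϱ.onIdele t = ϱ.onIdeal (ideleIdeal t) := by
  have h := onIdele_eq ϱ hm (t := t) (α := 1) (by rwa [map_one, one_mul])
  simpa using h

theorem valuation_eq_one_of_sub_le (hm : m ≠ ⊥) {v : HeightOneSpectrum (𝓞 K)}
    (hv : m ≤ v.asIdeal) {x y : K} (hx : v.valuation K x = 1)
    (h : v.valuation K (y - x) ≤
      WithZero.exp (-FractionalIdeal.count K v (m : FractionalIdeal (𝓞 K)⁰ K))) :
    v.valuation K y = 1 := by
  have h1 := Valuation.map_add_eq_of_lt_right (v.valuation K)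
    (x := y - x) (y := x) (by rw [hx]; exact h.trans_lt (exp_neg_count_lt_one hm hv))
  rwa [sub_add_cancel, hx] at h1

/-- The quotient `y/x` is congruent to 1 modulo `𝔪`, so `ϱ` of its ideal is `(y/x)^{k-1}`; in other
words, `η` sees only the residue class. -/
theorem onIdeal_eq_eta_mul (hm : m ≠ ⊥) {x y : Kˣ}
    (hx : ∀ v : HeightOneSpectrum (𝓞 K), m ≤ v.asIdeal → v.valuation K (x : K) = 1)
    (hxy : ∀ v : HeightOneSpectrum (𝓞 K), m ≤ v.asIdeal → v.valuation K ((y : K) - x) ≤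
      WithZero.exp (-FractionalIdeal.count K v (m : FractionalIdeal (𝓞 K)⁰ K))) :
    ϱ.onIdeal (toPrincipalIdeal (𝓞 K) K y) = ϱ.eta x * σ y ^ (k - 1) := by
  have h1 : FiniteAdeleRing.unitEmbedding (𝓞 K) K (y * x⁻¹) ∈ coprimeIdeles m := by
    rw [mem_coprimeIdeles_iff hm]
    intro v hv
    have e : ((FiniteAdeleRing.unitEmbedding (𝓞 K) K (y * x⁻¹) : (FiniteAdeleRing (𝓞 K) K)ˣ) :
        FiniteAdeleRing (𝓞 K) K) v - 1 = (((y - x) / x : K) : v.adicCompletion K) := by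
      rw [sub_eq_iff_eq_add, ← HeightOneSpectrum.adicCompletion.coe_one,
        ← HeightOneSpectrum.adicCompletion.coe_add, div_add_one x.ne_zero, sub_add_cancel,
        div_eq_mul_inv, ← Units.val_inv_eq_inv_val, ← Units.val_mul]
      rfl
    rw [e, HeightOneSpectrum.valuedAdicCompletion_eq_valuation', map_div₀, hx v hv, div_one]
    exact hxy v hv
  have h2 := onIdeal_toPrincipalIdeal ϱ hm h1
  have h3 := ideleIdeal_mem_coprimeIdeals hm h1
  rw [ideleIdeal_unitEmbedding] at h3
  have h4 := onIdeal_mul ϱ h3 (toPrincipalIdeal (𝓞 K) K x)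
  rw [← map_mul, inv_mul_cancel_right, h2] at h4
  have hx0 : σ x ≠ 0 := (map_ne_zero σ).2 x.ne_zero
  rw [h4, HeckeCharacter.eta, Units.val_mul, map_mul, mul_pow, Units.val_inv_eq_inv_val, map_inv₀,
    inv_pow]
  field_simp

end Character

/-! ### Residue classes modulo `𝔪` of elements that are units at `𝔪`. -/

section Residues

variable {K : Type*} [Field K] {m : Ideal (𝓞 K)}

theorem exists_heightOne_of_sup_ne_top (hm : m ≠ ⊥) {D : Ideal (𝓞 K)} (h : D ⊔ m ≠ ⊤) :
    ∃ v : HeightOneSpectrum (𝓞 K), m ≤ v.asIdeal ∧ D ≤ v.asIdeal := by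
  obtain ⟨M, hM, hle⟩ := Ideal.exists_le_maximal _ h
  exact ⟨⟨M, hM.isPrime, fun h0 => hm (le_bot_iff.1 (h0 ▸ le_sup_right.trans hle))⟩,
    le_sup_right.trans hle, le_sup_left.trans hle⟩

theorem algebraMap_mem_coeIdeal_iff (x : 𝓞 K) :
    algebraMap (𝓞 K) K x ∈ (m : FractionalIdeal (𝓞 K)⁰ K) ↔ x ∈ m := by
  rw [FractionalIdeal.mem_coeIdeal]
  constructor
  · rintro ⟨y, hy, h⟩
    rwa [← FaithfulSMul.algebraMap_injective (𝓞 K) K h]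
  · exact fun h => ⟨x, h, rfl⟩

variable [NumberField K]

/-- The denominator ideal of `y` is prime to `𝔪`, so `1 = d + e` with `dy` integral and `e ∈ 𝔪`.
Then `z = dy` works, because `y - z = ey`. -/
theorem exists_unit_residue (hm : m ≠ ⊥) {y : K}
    (hy : ∀ v : HeightOneSpectrum (𝓞 K), m ≤ v.asIdeal → v.valuation K y = 1) :
    ∃ z : 𝓞 K, IsUnit (Ideal.Quotient.mk m z) ∧ ∀ v : HeightOneSpectrum (𝓞 K), m ≤ v.asIdeal →
      v.valuation K (y - algebraMap (𝓞 K) K z) ≤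
        WithZero.exp (-FractionalIdeal.count K v (m : FractionalIdeal (𝓞 K)⁰ K)) := by
  have hm' : (m : FractionalIdeal (𝓞 K)⁰ K) ≠ 0 := FractionalIdeal.coeIdeal_ne_zero.2 hm
  let D : Ideal (𝓞 K) := Submodule.comap (LinearMap.toSpanSingleton (𝓞 K) K y)
    (1 : Submodule (𝓞 K) K)
  have hD : ∀ d : 𝓞 K, d ∈ D ↔ ∃ n : 𝓞 K, algebraMap (𝓞 K) K n = algebraMap (𝓞 K) K d * y := by
    intro d
    change LinearMap.toSpanSingleton (𝓞 K) K y d ∈ (1 : Submodule (𝓞 K) K) ↔ _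
    rw [Submodule.mem_one, LinearMap.toSpanSingleton_apply, Algebra.smul_def]
  have htop : D ⊔ m = ⊤ := by
    by_contra h
    obtain ⟨v, hv, hDv⟩ := exists_heightOne_of_sup_ne_top hm h
    obtain ⟨n, d, hd⟩ := v.exists_primeCompl_mul_eq_of_integer y (hy v hv).le
    exact d.2 (hDv ((hD d).2 ⟨n, by rw [← hd, mul_comm]⟩))
  obtain ⟨d, hd, e, he, hde⟩ := Submodule.mem_sup.1 ((Ideal.eq_top_iff_one _).1 htop)
  obtain ⟨z, hz⟩ := (hD d).1 hd
  have hclose : ∀ v : HeightOneSpectrum (𝓞 K), m ≤ v.asIdeal →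
      v.valuation K (y - algebraMap (𝓞 K) K z) ≤
        WithZero.exp (-FractionalIdeal.count K v (m : FractionalIdeal (𝓞 K)⁰ K)) := by
    intro v hv
    have h1 : y - algebraMap (𝓞 K) K z = algebraMap (𝓞 K) K e * y := by
      have := congrArg (algebraMap (𝓞 K) K) hde
      rw [map_add, map_one] at this
      rw [hz]
      linear_combination (-y) * this
    rw [h1, map_mul, hy v hv, mul_one]
    exact (mem_iff_valuation_le hm' _).1 ((algebraMap_mem_coeIdeal_iff e).2 he) v
  refine ⟨z, ?_, hclose⟩
  have htop' : Ideal.span {z} ⊔ m = ⊤ := by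
    by_contra h
    obtain ⟨v, hv, hzv⟩ := exists_heightOne_of_sup_ne_top hm h
    have h1 := hclose v hv
    rw [Valuation.map_sub_swap] at h1
    have h2 := valuation_eq_one_of_sub_le hm hv (hy v hv) h1
    rw [HeightOneSpectrum.valuation_eq_one_iff_notMem] at h2
    exact h2 (hzv (Ideal.mem_span_singleton_self z))
  obtain ⟨a, ha, b, hb, hab⟩ := Submodule.mem_sup.1 ((Ideal.eq_top_iff_one _).1 htop')
  obtain ⟨c, rfl⟩ := Ideal.mem_span_singleton'.1 ha
  refine IsUnit.of_mul_eq_one (Ideal.Quotient.mk m c) ?_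
  rw [← map_mul, mul_comm, ← map_one (Ideal.Quotient.mk m), ← hab, map_add,
    Ideal.Quotient.eq_zero_iff_mem.2 hb, add_zero]

theorem valuation_eq_one_of_isUnit_mk {z : 𝓞 K} (hz : IsUnit (Ideal.Quotient.mk m z))
    {v : HeightOneSpectrum (𝓞 K)} (hv : m ≤ v.asIdeal) :
    v.valuation K (algebraMap (𝓞 K) K z) = 1 := by
  rw [HeightOneSpectrum.valuation_eq_one_iff_notMem]
  intro hzv
  have h1 := hz.map (Ideal.Quotient.factor hv)
  rw [Ideal.Quotient.factor_mk, Ideal.Quotient.eq_zero_iff_mem.2 hzv] at h1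
  exact not_isUnit_zero h1

theorem mk_eq_mk_of_valuation_sub_le (hm : m ≠ ⊥) {y z : 𝓞 K}
    (h : ∀ v : HeightOneSpectrum (𝓞 K), m ≤ v.asIdeal →
      v.valuation K (algebraMap (𝓞 K) K y - algebraMap (𝓞 K) K z) ≤
        WithZero.exp (-FractionalIdeal.count K v (m : FractionalIdeal (𝓞 K)⁰ K))) :
    Ideal.Quotient.mk m y = Ideal.Quotient.mk m z := by
  have hm' : (m : FractionalIdeal (𝓞 K)⁰ K) ≠ 0 := FractionalIdeal.coeIdeal_ne_zero.2 hm
  rw [Ideal.Quotient.eq, ← algebraMap_mem_coeIdeal_iff, mem_iff_valuation_le hm']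
  intro v
  by_cases hv : m ≤ v.asIdeal
  · rw [map_sub]
    exact h v hv
  · rw [count_eq_zero_of_not_le hm hv, neg_zero, WithZero.exp_zero]
    exact v.valuation_le_one _

theorem valuation_sub_le_of_mk_eq_mk (hm : m ≠ ⊥) {y z : 𝓞 K}
    (h : Ideal.Quotient.mk m y = Ideal.Quotient.mk m z) (v : HeightOneSpectrum (𝓞 K)) :
    v.valuation K (algebraMap (𝓞 K) K y - algebraMap (𝓞 K) K z) ≤
      WithZero.exp (-FractionalIdeal.count K v (m : FractionalIdeal (𝓞 K)⁰ K)) := by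
  have hm' : (m : FractionalIdeal (𝓞 K)⁰ K) ≠ 0 := FractionalIdeal.coeIdeal_ne_zero.2 hm
  rw [Ideal.Quotient.eq, ← algebraMap_mem_coeIdeal_iff, mem_iff_valuation_le hm', map_sub] at h
  exact h v

end Residues

end CMTheta
end

noncomputable section
namespace CMTheta

/-! ### Compactness of the integral ideles, so that open subgroups have finite index. -/

section Compactness

variable {K : Type*} [Field K] [NumberField K]

/-- By density every residue is represented by an element of `K` integral at `v`, hence by an
element of `𝓞 K`. The residue field is thus a quotient of the finite ring `𝓞 K ⧸ v.asIdeal`. -/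
instance finite_residueField_adicCompletion (v : HeightOneSpectrum (𝓞 K)) :
    Finite (IsLocalRing.ResidueField (v.adicCompletionIntegers K)) := by
  let f : 𝓞 K →+* IsLocalRing.ResidueField (v.adicCompletionIntegers K) :=
    (IsLocalRing.residue _).comp (algebraMap (𝓞 K) (v.adicCompletionIntegers K))
  have hsurj : Function.Surjective f := by
    intro y
    obtain ⟨x, rfl⟩ := IsLocalRing.residue_surjective y
    obtain ⟨a, ha⟩ := exists_valued_sub_le v (x : v.adicCompletion K) (-1)
    have h1 : WithZero.exp (-1 : ℤ) < (1 : WithZero (Multiplicative ℤ)) := by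
      rw [← WithZero.exp_zero, WithZero.exp_lt_exp]; norm_num
    have ha1 : v.valuation K a ≤ 1 := by
      rw [← HeightOneSpectrum.valuedAdicCompletion_eq_valuation']
      have := Valuation.map_add Valued.v ((a : v.adicCompletion K) - x) x
      rw [sub_add_cancel] at this
      exact this.trans (max_le (ha.trans h1.le) x.2)
    obtain ⟨b, hb⟩ := HeightOneSpectrum.exists_valuation_sub_lt_of_integer v ha1 1
    refine ⟨b, ?_⟩
    change IsLocalRing.residue _ _ = IsLocalRing.residue _ _
    rw [← sub_eq_zero, ← map_sub, IsLocalRing.residue_eq_zero_iff]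
    rw [IsLocalRing.mem_maximalIdeal, mem_nonunits_iff,
      HeightOneSpectrum.adicCompletionIntegers.isUnit_iff_valued_eq_one]
    apply ne_of_lt
    have e : ((algebraMap (𝓞 K) (v.adicCompletionIntegers K) b - x :
        v.adicCompletionIntegers K) : v.adicCompletion K) =
        ((algebraMap (𝓞 K) K b - a : K) : v.adicCompletion K) +
          ((a : v.adicCompletion K) - x) := by
      have h2 : ((algebraMap (𝓞 K) K b - a : K) : v.adicCompletion K) + a =
          (algebraMap (𝓞 K) K b : v.adicCompletion K) := by
        rw [← HeightOneSpectrum.adicCompletion.coe_add, sub_add_cancel]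
      rw [add_sub, h2]
      rfl
    rw [e]
    refine Valuation.map_add_lt _ ?_ (ha.trans_lt h1)
    rw [HeightOneSpectrum.valuedAdicCompletion_eq_valuation']
    simpa using hb
  have hker : v.asIdeal ≤ RingHom.ker f := by
    intro a ha
    change IsLocalRing.residue _ _ = 0
    rw [IsLocalRing.residue_eq_zero_iff, IsLocalRing.mem_maximalIdeal, mem_nonunits_iff,
      HeightOneSpectrum.adicCompletionIntegers.isUnit_iff_valued_eq_one]
    apply ne_of_lt
    change Valued.v ((algebraMap (𝓞 K) K a : K) : v.adicCompletion K) < 1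
    rw [HeightOneSpectrum.valuedAdicCompletion_eq_valuation',
      HeightOneSpectrum.valuation_lt_one_iff_mem]
    exact ha
  have : Finite (𝓞 K ⧸ v.asIdeal) := v.asIdeal.finiteQuotientOfFreeOfNeBot v.ne_bot
  refine Finite.of_surjective (Ideal.Quotient.lift v.asIdeal f fun a ha => hker ha) ?_
  exact Ideal.Quotient.lift_surjective_of_surjective _ _ hsurj

instance compactSpace_adicCompletionIntegers (v : HeightOneSpectrum (𝓞 K)) :
    CompactSpace (v.adicCompletionIntegers K) := by
  have hclosed : IsClosed (v.adicCompletionIntegers K : Set (v.adicCompletion K)) :=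
    Valued.isClosed_valuationSubring _
  refine (Valued.integer.compactSpace_iff_completeSpace_and_isDiscreteValuationRing_and_finite_residueField
    (K := v.adicCompletion K)).2 ⟨?_, ?_, ?_⟩
  · exact hclosed.completeSpace_coe
  · exact inferInstanceAs (IsDiscreteValuationRing (v.adicCompletionIntegers K))
  · exact inferInstanceAs (Finite (IsLocalRing.ResidueField (v.adicCompletionIntegers K)))

/-- The topology on units is that of pairs `(u, u⁻¹)`. The integral ideles are therefore a
continuous image of the closed set `pq = 1` in a product of compact rings. -/
theorem isCompact_integralUnits :
    IsCompact (integralUnits K : Set (FiniteAdeleRing (𝓞 K) K)ˣ) := by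
  let X := {p : (Π v : HeightOneSpectrum (𝓞 K), v.adicCompletionIntegers K) ×
    (Π v : HeightOneSpectrum (𝓞 K), v.adicCompletionIntegers K) // p.1 * p.2 = 1}
  have : CompactSpace X := isCompact_iff_compactSpace.1
    (isClosed_eq (continuous_fst.mul continuous_snd) continuous_const).isCompact
  let ι : (Π v : HeightOneSpectrum (𝓞 K), v.adicCompletionIntegers K) → FiniteAdeleRing (𝓞 K) K :=
    RestrictedProduct.structureMap _ _ _
  have hι : Continuous ι := RestrictedProduct.isEmbedding_structureMap.continuous
  have hmul : ∀ p : X, ι p.1.1 * ι p.1.2 = 1 := fun p => FiniteAdeleRing.ext K fun v =>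
    congrArg Subtype.val (congrFun p.2 v)
  let F : X → (FiniteAdeleRing (𝓞 K) K)ˣ := fun p =>
    ⟨ι p.1.1, ι p.1.2, hmul p, by rw [mul_comm, hmul p]⟩
  have hF : Continuous F := Units.continuous_iff.2
    ⟨hι.comp (continuous_fst.comp continuous_subtype_val),
      hι.comp (continuous_snd.comp continuous_subtype_val)⟩
  have hrange : Set.range F = (integralUnits K : Set (FiniteAdeleRing (𝓞 K) K)ˣ) := by
    ext u
    constructor
    · rintro ⟨p, rfl⟩ v
      refine le_antisymm (p.1.1 v).2 ?_
      have h1 := congrArg Valued.v (congrArg Subtype.val (congrFun p.2 v))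
      change Valued.v (((p.1.1 v : v.adicCompletionIntegers K) : v.adicCompletion K) *
        ((p.1.2 v : v.adicCompletionIntegers K) : v.adicCompletion K)) =
          Valued.v (1 : v.adicCompletion K) at h1
      rw [map_mul, map_one] at h1
      rw [← h1]
      exact mul_le_of_le_one_right' (p.1.2 v).2
    · intro hu
      refine ⟨⟨⟨fun v => ⟨_, (hu v).le⟩, fun v => ⟨_, ((inv_mem hu : u⁻¹ ∈ integralUnits K) v).le⟩⟩,
        ?_⟩, Units.ext rfl⟩
      funext v
      exact Subtype.ext (congrArg (fun x : FiniteAdeleRing (𝓞 K) K => x v) u.mul_inv)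
  rw [← hrange]
  exact isCompact_range hF

theorem relIndex_ne_zero_of_isOpen {Kf : Subgroup (FiniteAdeleRing (𝓞 K) K)ˣ}
    (h : IsOpen (Kf : Set (FiniteAdeleRing (𝓞 K) K)ˣ)) : Kf.relIndex (integralUnits K) ≠ 0 := by
  have : CompactSpace (integralUnits K) := isCompact_iff_compactSpace.1 isCompact_integralUnits
  have : Finite (integralUnits K ⧸ Kf.subgroupOf (integralUnits K)) :=
    Subgroup.quotient_finite_of_isOpen _ (Subgroup.subgroupOf_isOpen _ _ h)
  exact Subgroup.index_ne_zero_of_finite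

end Compactness

end CMTheta
end

noncomputable section
namespace CMTheta

/-! ### Unfolding the sum over residue classes into values of `ϱ` on ideals. -/

section Unfolding

variable {K : Type*} [Field K] [NumberField K] {m : Ideal (𝓞 K)}

/-- At a prime dividing `𝔪`, both `u` and `t` are units and `u ≡ 1`, so dividing by `u` does not
move the class of `r` modulo `𝔪`. At any other prime `r` lies in the local lattice itself, so the
coset is the lattice and only divisibility by `ut` remains. -/
theorem valued_sub_le_iff (hm : m ≠ ⊥) {t u : (FiniteAdeleRing (𝓞 K) K)ˣ}
    (ht : t ∈ coprimeIdeles m) (hu : u ∈ coprimeIdeles m) {r : K}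
    (hr : r ∈ (ideleIdeal t : FractionalIdeal (𝓞 K)⁰ K)) (y : K) (v : HeightOneSpectrum (𝓞 K)) :
    Valued.v (((u : FiniteAdeleRing (𝓞 K) K) v)⁻¹ * (y : v.adicCompletion K) - r) ≤
        WithZero.exp (-FractionalIdeal.count K v
          ((m : FractionalIdeal (𝓞 K)⁰ K) * ideleIdeal t)) ↔
      v.valuation K y ≤ WithZero.exp
          (-FractionalIdeal.count K v (ideleIdeal (u * t) : FractionalIdeal (𝓞 K)⁰ K)) ∧
        (m ≤ v.asIdeal → v.valuation K (y - r) ≤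
          WithZero.exp (-FractionalIdeal.count K v (m : FractionalIdeal (𝓞 K)⁰ K))) := by
  have hm' : (m : FractionalIdeal (𝓞 K)⁰ K) ≠ 0 := FractionalIdeal.coeIdeal_ne_zero.2 hm
  have hu0 := idele_apply_ne_zero u v
  have hvr : Valued.v (r : v.adicCompletion K) ≤ WithZero.exp
      (-FractionalIdeal.count K v (ideleIdeal t : FractionalIdeal (𝓞 K)⁰ K)) := by
    rw [HeightOneSpectrum.valuedAdicCompletion_eq_valuation']
    exact (mem_iff_valuation_le (Units.ne_zero _) r).1 hr v
  rw [FractionalIdeal.count_mul K v hm' (Units.ne_zero _), ideleIdeal_mul, Units.val_mul,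
    FractionalIdeal.count_mul K v (Units.ne_zero _) (Units.ne_zero _),
    ← HeightOneSpectrum.valuedAdicCompletion_eq_valuation',
    ← HeightOneSpectrum.valuedAdicCompletion_eq_valuation']
  have hsub : ((y - r : K) : v.adicCompletion K) = (y : v.adicCompletion K) - r := by
    rw [eq_sub_iff_add_eq, ← HeightOneSpectrum.adicCompletion.coe_add, sub_add_cancel]
  rw [hsub]
  generalize hY : (y : v.adicCompletion K) = Y
  generalize hR : (r : v.adicCompletion K) = R at hvr ⊢
  by_cases hv : m ≤ v.asIdeal
  · have ct : FractionalIdeal.count K v (ideleIdeal t : FractionalIdeal (𝓞 K)⁰ K) = 0 :=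
      ideleIdeal_mem_coprimeIdeals hm ht v hv
    have cu : FractionalIdeal.count K v (ideleIdeal u : FractionalIdeal (𝓞 K)⁰ K) = 0 :=
      ideleIdeal_mem_coprimeIdeals hm hu v hv
    have hu1 := valued_eq_one_of_mem_coprimeIdeles hm hu hv
    have hu2 := (mem_coprimeIdeles_iff hm u).1 hu v hv
    rw [ct, neg_zero, WithZero.exp_zero] at hvr
    simp only [ct, cu, add_zero, neg_zero, WithZero.exp_zero, hv, true_implies]
    have hur : Valued.v (((u : FiniteAdeleRing (𝓞 K) K) v - 1) * R) ≤
        WithZero.exp (-FractionalIdeal.count K v (m : FractionalIdeal (𝓞 K)⁰ K)) := by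
      rw [map_mul]
      exact (mul_le_mul' hu2 hvr).trans (mul_one _).le
    have e : ((u : FiniteAdeleRing (𝓞 K) K) v)⁻¹ * Y - R =
        ((Y - R) - ((u : FiniteAdeleRing (𝓞 K) K) v - 1) * R) /
          (u : FiniteAdeleRing (𝓞 K) K) v := by
      field_simp
      ring
    rw [e, map_div₀, hu1, div_one]
    constructor
    · intro h
      have h1 : Valued.v (Y - R) ≤
          WithZero.exp (-FractionalIdeal.count K v (m : FractionalIdeal (𝓞 K)⁰ K)) := by
        have := Valuation.map_add Valued.v ((Y - R) - ((u : FiniteAdeleRing (𝓞 K) K) v - 1) * R)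
          (((u : FiniteAdeleRing (𝓞 K) K) v - 1) * R)
        rw [sub_add_cancel] at this
        exact this.trans (max_le h hur)
      refine ⟨?_, h1⟩
      have := Valuation.map_add Valued.v (Y - R) R
      rw [sub_add_cancel] at this
      exact this.trans (max_le (h1.trans (exp_neg_count_lt_one hm hv).le) hvr)
    · rintro ⟨-, h⟩
      exact (Valuation.map_sub _ _ _).trans (max_le h hur)
  · simp only [hv, false_implies, and_true, count_eq_zero_of_not_le hm hv, zero_add]
    have hvu := valued_idele u v
    have e : Valued.v Y = Valued.v ((u : FiniteAdeleRing (𝓞 K) K) v) *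
        Valued.v (((u : FiniteAdeleRing (𝓞 K) K) v)⁻¹ * Y) := by
      rw [← map_mul, mul_inv_cancel_left₀ hu0]
    rw [e, hvu, neg_add, WithZero.exp_add,
      mul_le_mul_iff_right₀ (WithZero.zero_lt_coe _)]
    constructor
    · intro h
      have := Valuation.map_add Valued.v (((u : FiniteAdeleRing (𝓞 K) K) v)⁻¹ * Y - R) R
      rw [sub_add_cancel] at this
      exact this.trans (max_le h hvr)
    · intro h
      exact (Valuation.map_sub _ _ _).trans (max_le h hvr)

open Classical in
theorem cosetIndicator_apply (hm : m ≠ ⊥) {s t : (FiniteAdeleRing (𝓞 K) K)ˣ} {α : Kˣ}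
    (ht : t ∈ coprimeIdeles m)
    (hα : FiniteAdeleRing.unitEmbedding (𝓞 K) K α * s ∈ coprimeIdeles m) {r : K}
    (hr : r ∈ (ideleIdeal t : FractionalIdeal (𝓞 K)⁰ K)) (y : K) :
    cosetIndicator ((m : FractionalIdeal (𝓞 K)⁰ K) * (ideleIdeal t : FractionalIdeal (𝓞 K)⁰ K)) r
        ((s⁻¹ : (FiniteAdeleRing (𝓞 K) K)ˣ) * algebraMap K _ ((α : K)⁻¹ * y)) =
      if y ∈ (ideleIdeal (FiniteAdeleRing.unitEmbedding (𝓞 K) K α * s * t) :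
          FractionalIdeal (𝓞 K)⁰ K) ∧
        ∀ v : HeightOneSpectrum (𝓞 K), m ≤ v.asIdeal → v.valuation K (y - r) ≤
          WithZero.exp (-FractionalIdeal.count K v (m : FractionalIdeal (𝓞 K)⁰ K)) then 1 else 0 := by
  have hm' : (m : FractionalIdeal (𝓞 K)⁰ K) ≠ 0 := FractionalIdeal.coeIdeal_ne_zero.2 hm
  rw [cosetIndicator, Set.indicator_apply]
  refine if_congr ?_ rfl rfl
  rw [mem_iff_valuation_le (Units.ne_zero _), ← forall_and]
  refine forall_congr' fun v => ?_
  rw [mem_localIdeal_iff v (mul_ne_zero hm' (Units.ne_zero _)),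
    ← valued_sub_le_iff hm ht hα hr y v]
  have e : ((((s⁻¹ : (FiniteAdeleRing (𝓞 K) K)ˣ) : FiniteAdeleRing (𝓞 K) K) *
      algebraMap K _ ((α : K)⁻¹ * y) - algebraMap K _ r : FiniteAdeleRing (𝓞 K) K)) v =
      (((FiniteAdeleRing.unitEmbedding (𝓞 K) K α * s : (FiniteAdeleRing (𝓞 K) K)ˣ) :
        FiniteAdeleRing (𝓞 K) K) v)⁻¹ * (y : v.adicCompletion K) - r := by
    have h1 : ((((s⁻¹ : (FiniteAdeleRing (𝓞 K) K)ˣ) : FiniteAdeleRing (𝓞 K) K) *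
      algebraMap K _ ((α : K)⁻¹ * y) - algebraMap K _ r : FiniteAdeleRing (𝓞 K) K)) v =
      ((s⁻¹ : (FiniteAdeleRing (𝓞 K) K)ˣ) : FiniteAdeleRing (𝓞 K) K) v *
        (((α : K)⁻¹ * y : K) : v.adicCompletion K) - r := rfl
    rw [h1, idele_inv_apply, idele_mul_apply, mul_inv, HeightOneSpectrum.adicCompletion.coe_mul]
    have h2 : ((((α : K)⁻¹ : K)) : v.adicCompletion K) =
        (((FiniteAdeleRing.unitEmbedding (𝓞 K) K α : (FiniteAdeleRing (𝓞 K) K)ˣ) :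
          FiniteAdeleRing (𝓞 K) K) v)⁻¹ :=
      map_inv₀ (algebraMap K (v.adicCompletion K)) (α : K)
    rw [h2]
    ring
  rw [e]

/-- This crude bound on the support holds for every idele `s` and suffices for convergence. -/
theorem mem_of_cosetIndicator_ne_zero (hm : m ≠ ⊥) {s t : (FiniteAdeleRing (𝓞 K) K)ˣ} {r : K}
    (hr : r ∈ (ideleIdeal t : FractionalIdeal (𝓞 K)⁰ K)) {x : K}
    (hx : cosetIndicator ((m : FractionalIdeal (𝓞 K)⁰ K) *
      (ideleIdeal t : FractionalIdeal (𝓞 K)⁰ K)) r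
        ((s⁻¹ : (FiniteAdeleRing (𝓞 K) K)ˣ) * algebraMap K _ x) ≠ 0) :
    x ∈ (ideleIdeal (s * t) : FractionalIdeal (𝓞 K)⁰ K) := by
  have hm' : (m : FractionalIdeal (𝓞 K)⁰ K) ≠ 0 := FractionalIdeal.coeIdeal_ne_zero.2 hm
  rw [cosetIndicator] at hx
  have hx1 := Set.mem_of_indicator_ne_zero hx
  rw [mem_iff_valuation_le (Units.ne_zero _)]
  intro v
  have hx2 := (mem_localIdeal_iff v (mul_ne_zero hm' (Units.ne_zero _)) _).1 (hx1 v)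
  have h1 : ((((s⁻¹ : (FiniteAdeleRing (𝓞 K) K)ˣ) : FiniteAdeleRing (𝓞 K) K) *
      algebraMap K _ x - algebraMap K _ r : FiniteAdeleRing (𝓞 K) K)) v =
      ((s⁻¹ : (FiniteAdeleRing (𝓞 K) K)ˣ) : FiniteAdeleRing (𝓞 K) K) v *
        (x : v.adicCompletion K) - r := rfl
  rw [h1, FractionalIdeal.count_mul K v hm' (Units.ne_zero _), idele_inv_apply] at hx2
  have hvr : Valued.v (r : v.adicCompletion K) ≤ WithZero.exp
      (-FractionalIdeal.count K v (ideleIdeal t : FractionalIdeal (𝓞 K)⁰ K)) := by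
    rw [HeightOneSpectrum.valuedAdicCompletion_eq_valuation']
    exact (mem_iff_valuation_le (Units.ne_zero _) r).1 hr v
  have hs0 := idele_apply_ne_zero s v
  rw [← HeightOneSpectrum.valuedAdicCompletion_eq_valuation', ideleIdeal_mul,
    Units.val_mul, FractionalIdeal.count_mul K v (Units.ne_zero _) (Units.ne_zero _), neg_add,
    WithZero.exp_add, ← valued_idele]
  generalize (x : v.adicCompletion K) = X at hx2 ⊢
  generalize (r : v.adicCompletion K) = R at hx2 hvr
  generalize (s : FiniteAdeleRing (𝓞 K) K) v = S at hx2 hs0 ⊢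
  have h3 := Valuation.map_add Valued.v (S⁻¹ * X - R) R
  rw [sub_add_cancel] at h3
  have h4 := h3.trans (max_le (hx2.trans (WithZero.exp_le_exp.2 (neg_le_neg
    (le_add_of_nonneg_left (FractionalIdeal.count_coe_nonneg K v m))))) hvr)
  have e : Valued.v X = Valued.v S * Valued.v (S⁻¹ * X) := by
    rw [← map_mul, mul_inv_cancel_left₀ hs0]
  rw [e]
  exact mul_le_mul' le_rfl h4

theorem norm_cosetIndicator_le (P : FractionalIdeal (𝓞 K)⁰ K) (r : K)
    (x : FiniteAdeleRing (𝓞 K) K) : ‖cosetIndicator P r x‖ ≤ 1 := by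
  classical
  rw [cosetIndicator, Set.indicator_apply]
  split_ifs <;> simp

variable {σ : K →+* ℂ} {k : ℕ} (ϱ : HeckeCharacter σ k m)

-- At most one `μ` is congruent to `y`, namely its residue class if `y` is a unit at `𝔪`. Otherwise
-- no `μ` contributes, which matches the extension of `ϱ` by zero.
open Classical in
theorem sum_eta_mul [Fintype (𝓞 K ⧸ m)ˣ] (hm : m ≠ ⊥) {r : (𝓞 K ⧸ m)ˣ → Kˣ}
    (hr : ∀ μ, ∃ z : 𝓞 K, algebraMap (𝓞 K) K z = r μ ∧ Ideal.Quotient.mk m z = μ) (y : Kˣ) :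
    ∑ μ, ϱ.eta (r μ) * (if ∀ v : HeightOneSpectrum (𝓞 K), m ≤ v.asIdeal →
        v.valuation K ((y : K) - r μ) ≤
          WithZero.exp (-FractionalIdeal.count K v (m : FractionalIdeal (𝓞 K)⁰ K))
        then 1 else 0) * σ y ^ (k - 1) = ϱ.onIdeal (toPrincipalIdeal (𝓞 K) K y) := by
  choose z hz hzμ using hr
  have hr1 : ∀ μ, ∀ v : HeightOneSpectrum (𝓞 K), m ≤ v.asIdeal → v.valuation K (r μ : K) = 1 := by
    intro μ v hv
    rw [← hz]
    exact valuation_eq_one_of_isUnit_mk (by rw [hzμ]; exact μ.isUnit) hv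
  by_cases hy : ∀ v : HeightOneSpectrum (𝓞 K), m ≤ v.asIdeal → v.valuation K (y : K) = 1
  · obtain ⟨x, hxu, hx⟩ := exists_unit_residue hm hy
    have hiff : ∀ μ, (∀ v : HeightOneSpectrum (𝓞 K), m ≤ v.asIdeal →
        v.valuation K ((y : K) - r μ) ≤
          WithZero.exp (-FractionalIdeal.count K v (m : FractionalIdeal (𝓞 K)⁰ K))) ↔
        μ = hxu.unit := by
      intro μ
      rw [← Units.val_inj, ← hzμ, IsUnit.unit_spec]
      constructor
      · intro h
        apply mk_eq_mk_of_valuation_sub_le hm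
        intro v hv
        have e : algebraMap (𝓞 K) K (z μ) - algebraMap (𝓞 K) K x =
            ((y : K) - algebraMap (𝓞 K) K x) - (y - r μ) := by rw [hz]; ring
        rw [e]
        exact (Valuation.map_sub _ _ _).trans (max_le (hx v hv) (h v hv))
      · intro h v hv
        have e : (y : K) - r μ = ((y : K) - algebraMap (𝓞 K) K x) -
            (algebraMap (𝓞 K) K (z μ) - algebraMap (𝓞 K) K x) := by rw [hz]; ring
        rw [e]
        exact (Valuation.map_sub _ _ _).trans
          (max_le (hx v hv) (valuation_sub_le_of_mk_eq_mk hm h v))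
    rw [Finset.sum_eq_single hxu.unit]
    · rw [if_pos ((hiff _).2 rfl), mul_one, onIdeal_eq_eta_mul ϱ hm (hr1 _) ((hiff _).2 rfl)]
    · intro μ _ hμ
      rw [if_neg fun h => hμ ((hiff μ).1 h), mul_zero, zero_mul]
    · exact fun h => (h (Finset.mem_univ _)).elim
  · rw [HeckeCharacter.onIdeal, dif_neg]
    · refine Finset.sum_eq_zero fun μ _ => ?_
      rw [if_neg, mul_zero, zero_mul]
      exact fun h => hy fun v hv => valuation_eq_one_of_sub_le hm hv (hr1 μ v hv) (h v hv)
    · intro h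
      refine hy fun v hv => ?_
      have := h v hv
      rw [coe_toPrincipalIdeal] at this
      rw [valuation_eq_exp_neg_count v y.ne_zero, this, neg_zero, WithZero.exp_zero]

-- The factor `0^{k-1}` is nonzero only for `k = 1`, as `0^0 = 1`. Even then 0 is not congruent to a
-- unit modulo `𝔪`, unless `𝔪` is the unit ideal and the congruence is vacuous.
open Classical in
theorem sum_eta_zero [Fintype (𝓞 K ⧸ m)ˣ] (hm : m ≠ ⊥) {r : (𝓞 K ⧸ m)ˣ → Kˣ}
    (hr : ∀ μ, ∃ z : 𝓞 K, algebraMap (𝓞 K) K z = r μ ∧ Ideal.Quotient.mk m z = μ) (hk : 1 ≤ k) :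
    ∑ μ, ϱ.eta (r μ) * (if ∀ v : HeightOneSpectrum (𝓞 K), m ≤ v.asIdeal →
        v.valuation K (0 - (r μ : K)) ≤
          WithZero.exp (-FractionalIdeal.count K v (m : FractionalIdeal (𝓞 K)⁰ K))
        then 1 else 0) * σ 0 ^ (k - 1) = if k = 1 ∧ m = ⊤ then 1 else 0 := by
  by_cases hk1 : k = 1
  swap
  · rw [map_zero, zero_pow (by omega), if_neg (fun h => hk1 h.1)]
    simp
  choose z hz hzμ using hr
  by_cases hmt : m = ⊤
  · rw [if_pos ⟨hk1, hmt⟩]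
    have hno : ∀ v : HeightOneSpectrum (𝓞 K), ¬ m ≤ v.asIdeal := fun v hv =>
      v.isPrime.ne_top (top_le_iff.1 (hmt ▸ hv))
    have : Subsingleton (𝓞 K ⧸ m) := Ideal.Quotient.subsingleton_iff.2 hmt
    have : Unique (𝓞 K ⧸ m)ˣ := ⟨⟨1⟩, fun a => Subsingleton.elim _ _⟩
    rw [Fintype.sum_unique, if_pos fun v hv => (hno v hv).elim, HeckeCharacter.eta,
      onIdeal_toPrincipalIdeal ϱ hm fun v hv => (hno v hv).elim]
    simp [hk1]
  · rw [if_neg (fun h => hmt h.2)]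
    obtain ⟨v, hv, -⟩ := exists_heightOne_of_sup_ne_top hm (D := ⊥) (by rwa [bot_sup_eq])
    refine Finset.sum_eq_zero fun μ _ => ?_
    rw [if_neg, mul_zero, zero_mul]
    intro h
    have h1 := h v hv
    have h2 : v.valuation K (r μ : K) = 1 := by
      rw [← hz]
      exact valuation_eq_one_of_isUnit_mk (by rw [hzμ]; exact μ.isUnit) hv
    rw [zero_sub, Valuation.map_neg, h2] at h1
    exact absurd (h1.trans_lt (exp_neg_count_lt_one hm hv)) (lt_irrefl _)

/-- The term `ϱ(I) q^{Nm I}` for a fractional ideal `I`. -/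
def fracTerm (τ : ℍ) (I : (FractionalIdeal (𝓞 K)⁰ K)ˣ) : ℂ :=
  ϱ.onIdeal I * Complex.exp (2 * Real.pi * Complex.I * τ *
    ((FractionalIdeal.absNorm (I : FractionalIdeal (𝓞 K)⁰ K) : ℚ) : ℂ))

open Classical in
/-- The term `ϱ(yB⁻¹) q^{Nm(yB⁻¹)}` for a nonzero element `y` of a fractional ideal `B`, extended
by zero to `K`. -/
def classTerm (τ : ℍ) (B : (FractionalIdeal (𝓞 K)⁰ K)ˣ) (y : K) : ℂ :=
  if hy : y ≠ 0 ∧ y ∈ (B : FractionalIdeal (𝓞 K)⁰ K) then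
    fracTerm ϱ τ (toPrincipalIdeal (𝓞 K) K (Units.mk0 y hy.1) * B⁻¹) else 0

open Classical in
/-- The constant term of the theta series attached to `B`. -/
def constTerm (B : (FractionalIdeal (𝓞 K)⁰ K)ˣ) : ℂ :=
  if k = 1 ∧ m = ⊤ then (ϱ.onIdeal B)⁻¹ else 0

variable [Algebra.IsQuadraticExtension ℚ K] [IsTotallyComplex K]

-- The value of `ϱ` at `h/h̄` carries a factor `α^{-(k-1)}`; its inverse cancels the one coming from
-- `x = α⁻¹ y`. What is left is `ϱ(B)⁻¹ ϱ(yO)` with the exponent `Nm(y)/Nm(B)`, plus the separate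
-- contribution of `y = 0`.
open Classical in
theorem sum_thetaTerm [Fintype (𝓞 K ⧸ m)ˣ] (hm : m ≠ ⊥) (hk : 1 ≤ k)
    {t h : (FiniteAdeleRing (𝓞 K) K)ˣ} {α : Kˣ} (ht : t ∈ coprimeIdeles m)
    (hα : FiniteAdeleRing.unitEmbedding (𝓞 K) K α * normMinus K h ∈ coprimeIdeles m)
    {r : (𝓞 K ⧸ m)ˣ → Kˣ} (hr : ∀ μ, (r μ : K) ∈ (ideleIdeal t : FractionalIdeal (𝓞 K)⁰ K) ∧
      ∃ z : 𝓞 K, algebraMap (𝓞 K) K z = r μ ∧ Ideal.Quotient.mk m z = μ) (τ : ℍ) (y : K) :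
    ∑ μ, (ϱ.onIdele t)⁻¹ * ϱ.eta (r μ) * ((ϱ.onIdele (normMinus K h))⁻¹ *
      thetaTerm σ k (FractionalIdeal.absNorm (ideleIdeal t : FractionalIdeal (𝓞 K)⁰ K))⁻¹
        (cosetIndicator ((m : FractionalIdeal (𝓞 K)⁰ K) *
          (ideleIdeal t : FractionalIdeal (𝓞 K)⁰ K)) (r μ)) h τ
          ((α : K)⁻¹ * y)) =
      classTerm ϱ τ (ideleIdeal (FiniteAdeleRing.unitEmbedding (𝓞 K) K α * normMinus K h * t)) y +
      if y = 0 then constTerm ϱ (ideleIdeal (FiniteAdeleRing.unitEmbedding (𝓞 K) K α *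
        normMinus K h * t)) else 0 := by
  set u := FiniteAdeleRing.unitEmbedding (𝓞 K) K α * normMinus K h with hu
  set B := ideleIdeal (u * t) with hB
  have hut : B = ideleIdeal t * ideleIdeal u := by rw [hB, ideleIdeal_mul, mul_comm]
  have hBc : B ∈ coprimeIdeals m :=
    ideleIdeal_mem_coprimeIdeals hm (mul_mem_coprimeIdeles hm hα ht)
  have hBmul : ϱ.onIdeal B = ϱ.onIdeal (ideleIdeal t) * ϱ.onIdeal (ideleIdeal u) := by
    rw [hut, onIdeal_mul ϱ (ideleIdeal_mem_coprimeIdeals hm ht)]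
  have hα0 : σ α ≠ 0 := (map_ne_zero σ).2 α.ne_zero
  -- The ideal of `h/h̄` drops out because it has norm 1.
  have hnormB : FractionalIdeal.absNorm (B : FractionalIdeal (𝓞 K)⁰ K) =
      Algebra.norm ℚ (α : K) *
        FractionalIdeal.absNorm (ideleIdeal t : FractionalIdeal (𝓞 K)⁰ K) := by
    rw [hB, hu, ideleIdeal_mul, ideleIdeal_mul, Units.val_mul, Units.val_mul, map_mul, map_mul,
      absNorm_ideleIdeal_normMinus, mul_one, ideleIdeal_unitEmbedding, coe_toPrincipalIdeal,
      FractionalIdeal.absNorm_span_singleton, abs_of_nonneg (algebraNorm_nonneg _)]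
  have hexp : (FractionalIdeal.absNorm (ideleIdeal t : FractionalIdeal (𝓞 K)⁰ K))⁻¹ *
      Algebra.norm ℚ ((α : K)⁻¹ * y) = Algebra.norm ℚ y *
        (FractionalIdeal.absNorm (B : FractionalIdeal (𝓞 K)⁰ K))⁻¹ := by
    have hinv : Algebra.norm ℚ (α : K)⁻¹ = (Algebra.norm ℚ (α : K))⁻¹ :=
      eq_inv_of_mul_eq_one_left (by rw [← map_mul, inv_mul_cancel₀ α.ne_zero, map_one])
    rw [hnormB, map_mul, hinv, mul_inv]
    field_simp
  set E := Complex.exp (2 * Real.pi * Complex.I * τ * ((Algebra.norm ℚ y *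
        (FractionalIdeal.absNorm (B : FractionalIdeal (𝓞 K)⁰ K))⁻¹ : ℚ) : ℂ)) with hE
  have hterm : ∀ μ, (ϱ.onIdele t)⁻¹ * ϱ.eta (r μ) * ((ϱ.onIdele (normMinus K h))⁻¹ *
      thetaTerm σ k (FractionalIdeal.absNorm (ideleIdeal t : FractionalIdeal (𝓞 K)⁰ K))⁻¹
        (cosetIndicator ((m : FractionalIdeal (𝓞 K)⁰ K) *
          (ideleIdeal t : FractionalIdeal (𝓞 K)⁰ K)) (r μ)) h τ
          ((α : K)⁻¹ * y)) = (ϱ.onIdeal B)⁻¹ * E *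
        (if y ∈ (B : FractionalIdeal (𝓞 K)⁰ K) then 1 else 0) *
        (ϱ.eta (r μ) * (if ∀ v : HeightOneSpectrum (𝓞 K), m ≤ v.asIdeal →
          v.valuation K (y - r μ) ≤
            WithZero.exp (-FractionalIdeal.count K v (m : FractionalIdeal (𝓞 K)⁰ K))
          then 1 else 0) * σ y ^ (k - 1)) := by
    intro μ
    rw [thetaTerm, hexp, cosetIndicator_apply hm ht hα (hr μ).1 y, onIdele_of_mem ϱ hm ht,
      onIdele_eq ϱ hm hα, ← hu, ← hB, ← hE, hBmul, map_mul, mul_pow, map_inv₀, ite_and]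
    rw [mul_inv, mul_inv, inv_inv, inv_pow]
    split_ifs <;> simp only [mul_zero, zero_mul, mul_one]
    field_simp
  rw [Finset.sum_congr rfl fun μ _ => hterm μ, ← Finset.mul_sum]
  rcases eq_or_ne y 0 with rfl | hy
  · rw [sum_eta_zero ϱ hm (fun μ => (hr μ).2) hk, if_pos rfl, classTerm,
      dif_neg (fun h => h.1 rfl), zero_add, constTerm, if_pos (FractionalIdeal.zero_mem _), hE,
      Algebra.norm_zero]
    simp
  · have h1 := sum_eta_mul ϱ hm (fun μ => (hr μ).2) (Units.mk0 y hy)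
    rw [Units.val_mk0] at h1
    rw [h1, if_neg hy, add_zero, classTerm]
    by_cases hyB : y ∈ (B : FractionalIdeal (𝓞 K)⁰ K)
    · rw [if_pos hyB, dif_pos ⟨hy, hyB⟩, fracTerm, onIdeal_inv_mul ϱ hBc, Units.val_mul, map_mul,
        coe_toPrincipalIdeal, FractionalIdeal.absNorm_span_singleton, Units.val_mk0,
        abs_of_nonneg (algebraNorm_nonneg _), Units.val_inv_eq_inv_val, map_inv₀]
      ring
    · rw [if_neg hyB, dif_neg (fun h => hyB h.2)]
      ring

theorem norm_thetaTerm (a : ℚ) (φ : FiniteAdeleRing (𝓞 K) K → ℂ)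
    (h : (FiniteAdeleRing (𝓞 K) K)ˣ) (τ : ℍ) (x : K) : ‖thetaTerm σ k a φ h τ x‖ =
      ‖φ (((normMinus K h)⁻¹ : (FiniteAdeleRing (𝓞 K) K)ˣ) * algebraMap K _ x)‖ *
        (‖σ x‖ ^ (k - 1) * Real.exp (-(2 * Real.pi * τ.im * (a : ℝ) * ‖σ x‖ ^ 2))) := by
  have h1 : (2 * (Real.pi : ℂ) * Complex.I * (τ : ℂ)).re = -(2 * Real.pi * τ.im) := by
    simp [Complex.mul_re, Complex.mul_im]
  have h2 : (2 * Real.pi * Complex.I * τ * ((a * Algebra.norm ℚ x : ℚ) : ℂ)).re =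
      -(2 * Real.pi * τ.im * (a : ℝ) * ‖σ x‖ ^ 2) := by
    rw [← norm_eq_norm_sq σ x, ← Complex.ofReal_ratCast, Complex.re_mul_ofReal, h1]
    push_cast
    ring
  rw [thetaTerm, norm_mul, norm_mul, norm_pow, Complex.norm_exp, mul_assoc, h2]

theorem summable_thetaTerm_of_support {a : ℚ} (ha : 0 < a) {φ : FiniteAdeleRing (𝓞 K) K → ℂ}
    (hφ : ∀ x, ‖φ x‖ ≤ 1) (h : (FiniteAdeleRing (𝓞 K) K)ˣ) (I : (FractionalIdeal (𝓞 K)⁰ K)ˣ)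
    (hI : ∀ x : K, φ (((normMinus K h)⁻¹ : (FiniteAdeleRing (𝓞 K) K)ˣ) * algebraMap K _ x) ≠ 0 →
      x ∈ (I : FractionalIdeal (𝓞 K)⁰ K)) (τ : ℍ) : Summable (thetaTerm σ k a φ h τ) := by
  have hc : 0 < 2 * Real.pi * τ.im * (a : ℝ) := by
    have := τ.im_pos
    have ha0' : (0 : ℝ) < (a : ℝ) := by exact_mod_cast ha
    positivity
  have h1 := summable_fractionalIdeal σ I (k - 1) hc
  have h2 : Function.support (thetaTerm σ k a φ h τ) ⊆
      {x : K | x ∈ (I : FractionalIdeal (𝓞 K)⁰ K)} := by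
    intro x hx
    refine hI x fun h0 => hx ?_
    rw [thetaTerm, h0, zero_mul, zero_mul]
  rw [← Set.indicator_eq_self.2 h2, ← summable_subtype_iff_indicator]
  refine h1.of_norm_bounded fun x => ?_
  rw [Function.comp_apply, norm_thetaTerm]
  exact mul_le_of_le_one_left (by positivity) (hφ _)

theorem summable_thetaTerm (hm : m ≠ ⊥) {t : (FiniteAdeleRing (𝓞 K) K)ˣ} {r : K}
    (hr : r ∈ (ideleIdeal t : FractionalIdeal (𝓞 K)⁰ K)) (h : (FiniteAdeleRing (𝓞 K) K)ˣ) (τ : ℍ) :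
    Summable (thetaTerm σ k
      (FractionalIdeal.absNorm (ideleIdeal t : FractionalIdeal (𝓞 K)⁰ K))⁻¹
        (cosetIndicator ((m : FractionalIdeal (𝓞 K)⁰ K) *
          (ideleIdeal t : FractionalIdeal (𝓞 K)⁰ K)) r) h τ) :=
  summable_thetaTerm_of_support
    (inv_pos.2 (lt_of_le_of_ne (FractionalIdeal.absNorm_nonneg _) fun h0 =>
      (Units.ne_zero _) (FractionalIdeal.absNorm_eq_zero_iff.1 h0.symm)))
    (norm_cosetIndicator_le _ _) h (ideleIdeal (normMinus K h * t))
    (fun _ hx => mem_of_cosetIndicator_ne_zero hm hr hx) τ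

end Unfolding

end CMTheta
end

noncomputable section
namespace CMTheta

/-! ### Sums over a fractional ideal as sums over an ideal class; constant terms. -/

section ClassSums

variable {K : Type*} [Field K] [NumberField K] {m : Ideal (𝓞 K)}

theorem toPrincipalIdeal_eq_one_iff (x : Kˣ) : toPrincipalIdeal (𝓞 K) K x = 1 ↔
    ∃ u : (𝓞 K)ˣ, Units.map (algebraMap (𝓞 K) K : 𝓞 K →* K) u = x := by
  have hmem : ∀ y : Kˣ, toPrincipalIdeal (𝓞 K) K y = 1 →
      ∃ z : 𝓞 K, algebraMap (𝓞 K) K z = y := by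
    intro y hy
    rw [toPrincipalIdeal_eq_iff, Units.val_one] at hy
    rw [← FractionalIdeal.mem_one_iff (𝓞 K)⁰, ← hy]
    exact FractionalIdeal.mem_spanSingleton_self _ _
  constructor
  · intro hx
    obtain ⟨z, hz⟩ := hmem x hx
    obtain ⟨w, hw⟩ := hmem x⁻¹ (by rw [map_inv, hx, inv_one])
    have hzw : z * w = 1 := by
      apply FaithfulSMul.algebraMap_injective (𝓞 K) K
      rw [map_mul, hz, hw, map_one, Units.mul_inv]
    exact ⟨Units.mkOfMulEqOne z w hzw, Units.ext hz⟩
  · rintro ⟨u, rfl⟩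
    rw [toPrincipalIdeal_eq_iff, Units.val_one]
    change FractionalIdeal.spanSingleton (𝓞 K)⁰ (algebraMap (𝓞 K) K u) = 1
    rw [← FractionalIdeal.coeIdeal_span_singleton, Ideal.span_singleton_eq_top.2 u.isUnit,
      FractionalIdeal.coeIdeal_top]

theorem exists_toPrincipalIdeal_eq_mul {B : (FractionalIdeal (𝓞 K)⁰ K)ˣ} {a : (Ideal (𝓞 K))⁰}
    (ha : ClassGroup.mk0 a = (ClassGroup.mk K B)⁻¹) :
    ∃ y : Kˣ, toPrincipalIdeal (𝓞 K) K y = FractionalIdeal.mk0 K a * B := by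
  rw [← classGroup_mk_eq_one_iff, map_mul, ClassGroup.mk_mk0, ha, inv_mul_cancel]

theorem mem_of_toPrincipalIdeal_eq {B : (FractionalIdeal (𝓞 K)⁰ K)ˣ} {a : (Ideal (𝓞 K))⁰} {y : Kˣ}
    (hy : toPrincipalIdeal (𝓞 K) K y = FractionalIdeal.mk0 K a * B) :
    (y : K) ∈ (B : FractionalIdeal (𝓞 K)⁰ K) := by
  rw [toPrincipalIdeal_eq_iff, Units.val_mul, FractionalIdeal.coe_mk0] at hy
  rw [← FractionalIdeal.spanSingleton_le_iff_mem, hy]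
  exact mul_le_of_le_one_left' FractionalIdeal.coeIdeal_le_one

theorem exists_mk0_eq_of_mem {B : (FractionalIdeal (𝓞 K)⁰ K)ˣ} {y : Kˣ}
    (hy : (y : K) ∈ (B : FractionalIdeal (𝓞 K)⁰ K)) :
    ∃ a : (Ideal (𝓞 K))⁰, ClassGroup.mk0 a = (ClassGroup.mk K B)⁻¹ ∧
      toPrincipalIdeal (𝓞 K) K y = FractionalIdeal.mk0 K a * B := by
  have h1 : ((toPrincipalIdeal (𝓞 K) K y * B⁻¹ : (FractionalIdeal (𝓞 K)⁰ K)ˣ) :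
      FractionalIdeal (𝓞 K)⁰ K) ≤ 1 := by
    rw [Units.val_mul, coe_toPrincipalIdeal, ← B.mul_inv]
    gcongr
    rwa [FractionalIdeal.spanSingleton_le_iff_mem]
  obtain ⟨a, ha⟩ := FractionalIdeal.le_one_iff_exists_coeIdeal.1 h1
  have ha0 : a ≠ 0 := by
    rintro rfl
    exact (Units.ne_zero _) (ha.symm.trans FractionalIdeal.coeIdeal_bot)
  have h2 : FractionalIdeal.mk0 K ⟨a, mem_nonZeroDivisors_of_ne_zero ha0⟩ =
      toPrincipalIdeal (𝓞 K) K y * B⁻¹ := Units.ext ha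
  refine ⟨⟨a, mem_nonZeroDivisors_of_ne_zero ha0⟩, ?_, by rw [h2, inv_mul_cancel_right]⟩
  rw [← ClassGroup.mk_mk0 K, h2, map_mul, map_inv, classGroup_mk_eq_one_iff.2 ⟨y, rfl⟩, one_mul]

/-- A generator of the principal ideal `aB`, times a unit. -/
def generatorMul (B : (FractionalIdeal (𝓞 K)⁰ K)ˣ)
    (p : {a : (Ideal (𝓞 K))⁰ // ClassGroup.mk0 a = (ClassGroup.mk K B)⁻¹} × (𝓞 K)ˣ) : Kˣ :=
  Units.map (algebraMap (𝓞 K) K : 𝓞 K →* K) p.2 * (exists_toPrincipalIdeal_eq_mul p.1.2).choose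

theorem toPrincipalIdeal_generatorMul (B : (FractionalIdeal (𝓞 K)⁰ K)ˣ)
    (p : {a : (Ideal (𝓞 K))⁰ // ClassGroup.mk0 a = (ClassGroup.mk K B)⁻¹} × (𝓞 K)ˣ) :
    toPrincipalIdeal (𝓞 K) K (generatorMul B p) = FractionalIdeal.mk0 K p.1.1 * B := by
  rw [generatorMul, map_mul, (toPrincipalIdeal_eq_one_iff _).2 ⟨p.2, rfl⟩, one_mul]
  exact (exists_toPrincipalIdeal_eq_mul p.1.2).choose_spec

/-- The ideal `yB⁻¹` determines the first component, and the quotient by the chosen generator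
determines the unit. With `exists_generatorMul_eq` this parametrizes the nonzero elements of `B` by
pairs of an integral ideal and a unit. -/
theorem generatorMul_injective (B : (FractionalIdeal (𝓞 K)⁰ K)ˣ) :
    Function.Injective fun p => (generatorMul B p : K) := by
  intro p q hpq
  have h := Units.ext hpq
  have h1 := congrArg (toPrincipalIdeal (𝓞 K) K) h
  rw [toPrincipalIdeal_generatorMul, toPrincipalIdeal_generatorMul, mul_left_inj] at h1
  have h2 : p.1 = q.1 := by
    apply Subtype.ext
    apply Subtype.ext
    apply FractionalIdeal.coeIdeal_injective (K := K)
    exact congrArg Units.val h1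
  obtain ⟨a, u⟩ := p
  obtain ⟨b, w⟩ := q
  obtain rfl : a = b := h2
  have h3 := mul_right_cancel h
  refine Prod.ext rfl (Units.ext (FaithfulSMul.algebraMap_injective (𝓞 K) K ?_))
  exact congrArg Units.val h3

theorem exists_generatorMul_eq {B : (FractionalIdeal (𝓞 K)⁰ K)ˣ} {y : Kˣ}
    (hy : (y : K) ∈ (B : FractionalIdeal (𝓞 K)⁰ K)) : ∃ p, generatorMul B p = y := by
  obtain ⟨a, ha, hya⟩ := exists_mk0_eq_of_mem hy
  have h1 := toPrincipalIdeal_generatorMul B ⟨⟨a, ha⟩, 1⟩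
  rw [← hya] at h1
  obtain ⟨u, hu⟩ := (toPrincipalIdeal_eq_one_iff (y * (generatorMul B ⟨⟨a, ha⟩, 1⟩)⁻¹)).1
    (by rw [map_mul, map_inv, h1, mul_inv_cancel])
  refine ⟨⟨⟨a, ha⟩, u⟩, ?_⟩
  rw [generatorMul, hu]
  simp [generatorMul]

variable {σ : K →+* ℂ} {k : ℕ} (ϱ : HeckeCharacter σ k m)

theorem fracTerm_mk0 (τ : ℍ) (a : (Ideal (𝓞 K))⁰) :
    fracTerm ϱ τ (FractionalIdeal.mk0 K a) = ϱ.formTerm τ a := by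
  rw [fracTerm, HeckeCharacter.formTerm, FractionalIdeal.coe_mk0, FractionalIdeal.coeIdeal_absNorm]
  norm_cast

theorem classTerm_generatorMul (τ : ℍ) (B : (FractionalIdeal (𝓞 K)⁰ K)ˣ)
    (p : {a : (Ideal (𝓞 K))⁰ // ClassGroup.mk0 a = (ClassGroup.mk K B)⁻¹} × (𝓞 K)ˣ) :
    classTerm ϱ τ B (generatorMul B p) = ϱ.formTerm τ p.1.1 := by
  have h := toPrincipalIdeal_generatorMul B p
  rw [classTerm, dif_pos ⟨(generatorMul B p).ne_zero, mem_of_toPrincipalIdeal_eq h⟩,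
    Units.mk0_val, h, mul_inv_cancel_right, fracTerm_mk0]

theorem classTerm_eq_zero (τ : ℍ) (B : (FractionalIdeal (𝓞 K)⁰ K)ˣ) {y : K}
    (hy : y ∉ Set.range fun p => (generatorMul B p : K)) : classTerm ϱ τ B y = 0 := by
  rw [classTerm, dif_neg]
  rintro ⟨h0, hB⟩
  obtain ⟨p, hp⟩ := exists_generatorMul_eq (y := Units.mk0 y h0) hB
  exact hy ⟨p, by simp only [hp, Units.val_mk0]⟩

/-- The part of the form `ϑ_ϱ` that comes from the ideal class `d`. -/
def classSum (τ : ℍ) (d : ClassGroup (𝓞 K)) : ℂ :=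
  ∑' a : {a : (Ideal (𝓞 K))⁰ // ClassGroup.mk0 a = d}, ϱ.formTerm τ a.1

/-- Restricting the sum over pairs to the unit 1 selects one generator for each ideal. -/
theorem summable_formTerm_class {τ : ℍ} {B : (FractionalIdeal (𝓞 K)⁰ K)ˣ}
    (h : Summable (classTerm ϱ τ B)) :
    Summable fun a : {a : (Ideal (𝓞 K))⁰ // ClassGroup.mk0 a = (ClassGroup.mk K B)⁻¹} =>
      ϱ.formTerm τ a.1 := by
  have h1 := h.comp_injective (generatorMul_injective B)
  have h2 := h1.comp_injective (Prod.mk_left_injective (1 : (𝓞 K)ˣ))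
  exact h2.congr fun a => classTerm_generatorMul ϱ τ B (a, 1)

/-- The term depends only on `yB⁻¹`, so each integral ideal of the class is counted once for every
unit. -/
theorem tsum_classTerm {τ : ℍ} {B : (FractionalIdeal (𝓞 K)⁰ K)ˣ}
    (h : Summable (classTerm ϱ τ B)) :
    ∑' y, classTerm ϱ τ B y = Nat.card (𝓞 K)ˣ * classSum ϱ τ (ClassGroup.mk K B)⁻¹ := by
  have h1 := h.comp_injective (generatorMul_injective B)
  have h2 : Function.support (classTerm ϱ τ B) ⊆ Set.range fun p => (generatorMul B p : K) :=
    fun y hy => by_contra fun h0 => hy (classTerm_eq_zero ϱ τ B h0)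
  rw [← (generatorMul_injective B).tsum_eq h2, classSum, ← tsum_mul_left]
  refine h1.tsum_prod.trans (tsum_congr fun a => ?_)
  rw [← nsmul_eq_mul, ← tsum_const]
  exact tsum_congr fun u => classTerm_generatorMul ϱ τ B (a, u)

theorem summable_formTerm {τ : ℍ} (h : ∀ d : ClassGroup (𝓞 K),
    Summable fun a : {a : (Ideal (𝓞 K))⁰ // ClassGroup.mk0 a = d} => ϱ.formTerm τ a.1) :
    Summable (ϱ.formTerm τ) := by
  rw [← summable_norm_iff, ← (Equiv.sigmaFiberEquiv (ClassGroup.mk0 (R := 𝓞 K))).summable_iff]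
  refine (summable_sigma_of_nonneg fun _ => norm_nonneg _).2 ⟨fun d => (h d).norm, Summable.of_finite⟩

theorem sum_classSum [Fintype (ClassGroup (𝓞 K))] {τ : ℍ} (h : Summable (ϱ.formTerm τ)) :
    ∑ d, classSum ϱ τ d = ϱ.form τ := by
  rw [HeckeCharacter.form, ← (Equiv.sigmaFiberEquiv (ClassGroup.mk0 (R := 𝓞 K))).tsum_eq,
    Summable.tsum_sigma, tsum_fintype]
  · rfl
  · exact (Equiv.summable_iff _).2 h

/-- The constant term of the theta series attached to an ideal class. -/
def constClass (d : ClassGroup (𝓞 K)) : ℂ :=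
  constTerm ϱ (Function.surjInv classGroup_mk_surjective d)

theorem mem_coprimeIdeals_top (I : (FractionalIdeal (𝓞 K)⁰ K)ˣ) (hm : m = ⊤) :
    I ∈ coprimeIdeals m := fun v hv => (v.isPrime.ne_top (top_le_iff.1 (hm ▸ hv))).elim

theorem constTerm_mul {I : (FractionalIdeal (𝓞 K)⁰ K)ˣ} (hI : I ∈ coprimeIdeals m)
    (J : (FractionalIdeal (𝓞 K)⁰ K)ˣ) :
    constTerm ϱ (I * J) = (ϱ.onIdeal I)⁻¹ * constTerm ϱ J := by
  rw [constTerm, constTerm]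
  split_ifs
  · rw [onIdeal_mul ϱ hI, mul_inv]
  · rw [mul_zero]

/-- In the only case with a constant term, `ϱ` has weight 1 and trivial modulus, so it is 1 on all
principal ideals. -/
theorem constTerm_toPrincipalIdeal_mul (hm : m ≠ ⊥) (x : Kˣ) (J : (FractionalIdeal (𝓞 K)⁰ K)ˣ) :
    constTerm ϱ (toPrincipalIdeal (𝓞 K) K x * J) = constTerm ϱ J := by
  by_cases h : k = 1 ∧ m = ⊤
  · rw [constTerm_mul ϱ (mem_coprimeIdeals_top _ h.2), onIdeal_toPrincipalIdeal ϱ hm,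
      show k - 1 = 0 by omega, pow_zero, inv_one, one_mul]
    exact fun v hv => (v.isPrime.ne_top (top_le_iff.1 (h.2 ▸ hv))).elim
  · rw [constTerm, constTerm, if_neg h, if_neg h]

theorem constClass_mk (hm : m ≠ ⊥) (B : (FractionalIdeal (𝓞 K)⁰ K)ˣ) :
    constClass ϱ (ClassGroup.mk K B) = constTerm ϱ B := by
  have h := Function.surjInv_eq classGroup_mk_surjective (ClassGroup.mk K B)
  rw [constClass]
  generalize Function.surjInv classGroup_mk_surjective (ClassGroup.mk K B) = J at h
  obtain ⟨x, hx⟩ := classGroup_mk_eq_one_iff.1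
    (show ClassGroup.mk K (J * B⁻¹) = 1 by rw [map_mul, map_inv, h, mul_inv_cancel])
  rw [← constTerm_toPrincipalIdeal_mul ϱ hm x B, hx, inv_mul_cancel_right]

/-- Orthogonality: translating by the class of an ideal with `ϱ ≠ 1` multiplies the sum by a factor
other than 1, yet only permutes its terms. -/
theorem sum_constClass [Fintype (ClassGroup (𝓞 K))] (hm : m ≠ ⊥)
    (hϱ : k = 1 → ∃ a, ϱ.toHom a ≠ 1) : ∑ d, constClass ϱ d = 0 := by
  by_cases h : k = 1 ∧ m = ⊤
  · obtain ⟨a, ha⟩ := hϱ h.1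
    have h1 : ϱ.onIdeal a = (ϱ.toHom a : ℂ) := by rw [HeckeCharacter.onIdeal, dif_pos a.2]
    have h2 : ∀ d, constClass ϱ (ClassGroup.mk K (a : (FractionalIdeal (𝓞 K)⁰ K)ˣ) * d) =
        (ϱ.toHom a : ℂ)⁻¹ * constClass ϱ d := by
      intro d
      obtain ⟨J, rfl⟩ := classGroup_mk_surjective d
      rw [← map_mul, constClass_mk ϱ hm, constClass_mk ϱ hm, constTerm_mul ϱ a.2, h1]
    have h3 := Equiv.sum_comp (Equiv.mulLeft (ClassGroup.mk K (a : (FractionalIdeal (𝓞 K)⁰ K)ˣ)))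
      (constClass ϱ)
    simp only [Equiv.coe_mulLeft, h2] at h3
    rw [← Finset.mul_sum] at h3
    by_contra h0
    have h4 := (mul_eq_right₀ h0).1 h3
    exact ha (Units.ext (inv_eq_one.1 h4))
  · exact Finset.sum_eq_zero fun d _ => by rw [constClass, constTerm, if_neg h]

end ClassSums

end CMTheta
end

noncomputable section
namespace CMTheta

/-! ### Averaging over class groups, and theta sums as functions of the ideal class. -/

section Averages

variable {K : Type*} [Field K] [NumberField K] {m : Ideal (𝓞 K)}
  {σ : K →+* ℂ} {k : ℕ} (ϱ : HeckeCharacter σ k m)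

theorem hasSum_comp_mul_left₀ {F : Type*} [DivisionRing F] {f : F → ℂ} {z : ℂ} {b : F}
    (hb : b ≠ 0) (hf : HasSum f z) : HasSum (fun y => f (b * y)) z :=
  (Equiv.mulLeft₀ b hb).hasSum_iff.2 hf

/-- The contribution of an ideal class to the weighted sum of theta series. -/
def classValue (τ : ℍ) (d : ClassGroup (𝓞 K)) : ℂ :=
  Nat.card (𝓞 K)ˣ * classSum ϱ τ d⁻¹ + constClass ϱ d

theorem sum_classValue [Fintype (ClassGroup (𝓞 K))] (hm : m ≠ ⊥)
    (hϱ : k = 1 → ∃ a, ϱ.toHom a ≠ 1) {τ : ℍ} (h : Summable (ϱ.formTerm τ)) :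
    ∑ d, classValue ϱ τ d = Nat.card (𝓞 K)ˣ * ϱ.form τ := by
  simp only [classValue]
  rw [Finset.sum_add_distrib, sum_constClass ϱ hm hϱ, add_zero, ← Finset.mul_sum,
    ← sum_classSum ϱ h]
  congr 1
  exact Equiv.sum_comp (Equiv.inv _) _

/-- The fibres of a surjective homomorphism of finite groups have equal size, so the average of `g ∘
f` is the average of `g`. -/
theorem card_mul_sum_comp {G H : Type*} [Group G] [Group H] [Fintype G] [Fintype H]
    (f : G →* H) (hf : Function.Surjective f) (g : H → ℂ) :
    (Fintype.card H : ℂ) * ∑ x, g (f x) = Fintype.card G * ∑ y, g y := by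
  have h1 : ∀ z : H, ∑ x, g (z * f x) = ∑ x, g (f x) := by
    intro z
    obtain ⟨w, rfl⟩ := hf z
    rw [← Equiv.sum_comp (Equiv.mulLeft w) fun x => g (f x)]
    simp
  calc (Fintype.card H : ℂ) * ∑ x, g (f x) = ∑ z : H, ∑ x, g (z * f x) := by
        simp [h1]
    _ = ∑ x : G, ∑ z, g (z * f x) := Finset.sum_comm
    _ = ∑ x : G, ∑ z, g z := Finset.sum_congr rfl fun x _ =>
        Equiv.sum_comp (Equiv.mulRight (f x)) g
    _ = Fintype.card G * ∑ y, g y := by simp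

/-- The map `Cl(K_f) → Cl(K)` for a subgroup `K_f` of `Ô_K^×`. -/
def classMap {Kf : Subgroup (FiniteAdeleRing (𝓞 K) K)ˣ} (hle : Kf ≤ integralUnits K) :
    IdeleClassGroup Kf →* ClassGroup (𝓞 K) :=
  QuotientGroup.lift _ (ideleClass K) (by
    rw [ker_ideleClass]
    exact sup_le_sup_left hle _)

theorem classMap_surjective {Kf : Subgroup (FiniteAdeleRing (𝓞 K) K)ˣ}
    (hle : Kf ≤ integralUnits K) : Function.Surjective (classMap hle) := fun d => by
  obtain ⟨t, rfl⟩ := ideleClass_surjective d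
  exact ⟨QuotientGroup.mk t, rfl⟩

/-- An infinite index has the value 0, and then the counting formula would make a product of
positive cardinalities vanish. For `K(𝔪)` this draws the finite index from the given finite set of
representatives. -/
theorem relIndex_ne_zero_of_finite [Finite (𝓞 K)ˣ] {Kf : Subgroup (FiniteAdeleRing (𝓞 K) K)ˣ}
    (hle : Kf ≤ integralUnits K) [Finite (IdeleClassGroup Kf)] :
    Kf.relIndex (integralUnits K) ≠ 0 := by
  intro h0
  have h := index_mul_card_units hle
  rw [h0, mul_zero, zero_mul] at h
  exact mul_ne_zero Nat.card_pos.ne' Nat.card_pos.ne' h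

theorem finite_ideleClassGroup [Finite (𝓞 K)ˣ] {Kf : Subgroup (FiniteAdeleRing (𝓞 K) K)ˣ}
    (hle : Kf ≤ integralUnits K) (h : Kf.relIndex (integralUnits K) ≠ 0) :
    Finite (IdeleClassGroup Kf) := by
  have : Finite (globalUnits K) := Finite.of_equiv _ (globalUnitsEquiv K).toEquiv
  have hE : Finite ↥(Kf ⊓ globalUnits K) :=
    Finite.of_injective _ (Subgroup.inclusion_injective (inf_le_right (a := Kf)))
  have h1 := index_mul_card_units hle
  refine Nat.finite_of_card_ne_zero fun h0 => ?_
  rw [h0, zero_mul] at h1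
  exact mul_ne_zero (mul_ne_zero Nat.card_pos.ne' h) Nat.card_pos.ne' h1.symm

theorem levelSubgroup_le (m : Ideal (𝓞 K)) : levelSubgroup m ≤ integralUnits K := fun _ hu => hu.1

theorem ideleClass_unitEmbedding_mul (α : Kˣ) (s t : (FiniteAdeleRing (𝓞 K) K)ˣ) :
    ClassGroup.mk K (ideleIdeal (FiniteAdeleRing.unitEmbedding (𝓞 K) K α * s * t)) =
      ideleClass K (t * s) := by
  change ideleClass K _ = _
  rw [mul_assoc, map_mul, ideleClass_unitEmbedding, one_mul, mul_comm]

variable [Algebra.IsQuadraticExtension ℚ K] [IsTotallyComplex K]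

/-- Conjugation preserves principal ideles and integral units, so `Nm⁻` descends to a homomorphism
from `Cl(K_f)` to the ideal class group. -/
theorem sup_le_ker_normMinus {Kf : Subgroup (FiniteAdeleRing (𝓞 K) K)ˣ}
    (hle : Kf ≤ integralUnits K) : (FiniteAdeleRing.unitEmbedding (𝓞 K) K).range ⊔ Kf ≤
      ((ideleClass K).comp (normMinus K)).ker := by
  refine sup_le ?_ fun u hu => ?_
  · rintro _ ⟨α, rfl⟩
    rw [MonoidHom.mem_ker, MonoidHom.comp_apply]
    exact normMinus_unitEmbedding α
  · rw [MonoidHom.mem_ker, MonoidHom.comp_apply]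
    exact ideleClass_eq_one_of_mem (normMinus_mem_integralUnits (hle hu))

/-- The map `Cl(K_f) → Cl(K)` induced by `Nm⁻`. -/
def normMinusClassMap {Kf : Subgroup (FiniteAdeleRing (𝓞 K) K)ˣ} (hle : Kf ≤ integralUnits K) :
    IdeleClassGroup Kf →* ClassGroup (𝓞 K) :=
  QuotientGroup.lift _ ((ideleClass K).comp (normMinus K)) (sup_le_ker_normMinus hle)

theorem normMinusClassMap_out {Kf : Subgroup (FiniteAdeleRing (𝓞 K) K)ˣ}
    (hle : Kf ≤ integralUnits K) (c : IdeleClassGroup Kf) :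
    ideleClass K (normMinus K c.out) = normMinusClassMap hle c := by
  conv_rhs => rw [← Quotient.out_eq' c]
  rfl

/-- The sum `ϱ(t)⁻¹ ϱ(h/h̄)⁻¹ ∑_μ η(μ) θ_{P+μ}(τ, h)` over the residue classes, `P = 𝔪𝔞`. -/
def thetaSum (t h : (FiniteAdeleRing (𝓞 K) K)ˣ) (r : (𝓞 K ⧸ m)ˣ → Kˣ) (τ : ℍ)
    [Fintype (𝓞 K ⧸ m)ˣ] : ℂ :=
  ∑ μ, (ϱ.onIdele t)⁻¹ * ϱ.eta (r μ) * ((ϱ.onIdele (normMinus K h))⁻¹ *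
      theta σ k (FractionalIdeal.absNorm (ideleIdeal t : FractionalIdeal (𝓞 K)⁰ K))⁻¹
        (cosetIndicator ((m : FractionalIdeal (𝓞 K)⁰ K) *
          (ideleIdeal t : FractionalIdeal (𝓞 K)⁰ K)) (r μ)) h τ)

theorem hasSum_sum_thetaTerm [Fintype (𝓞 K ⧸ m)ˣ] (hm : m ≠ ⊥)
    {t : (FiniteAdeleRing (𝓞 K) K)ˣ} (h : (FiniteAdeleRing (𝓞 K) K)ˣ) (α : Kˣ)
    {r : (𝓞 K ⧸ m)ˣ → Kˣ} (hr : ∀ μ, (r μ : K) ∈ (ideleIdeal t : FractionalIdeal (𝓞 K)⁰ K))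
    (τ : ℍ) :
    HasSum (fun y : K => ∑ μ, (ϱ.onIdele t)⁻¹ * ϱ.eta (r μ) *
      ((ϱ.onIdele (normMinus K h))⁻¹ *
      thetaTerm σ k (FractionalIdeal.absNorm (ideleIdeal t : FractionalIdeal (𝓞 K)⁰ K))⁻¹
        (cosetIndicator ((m : FractionalIdeal (𝓞 K)⁰ K) *
          (ideleIdeal t : FractionalIdeal (𝓞 K)⁰ K)) (r μ)) h τ
          ((α : K)⁻¹ * y))) (thetaSum ϱ t h r τ) := by
  refine hasSum_sum fun μ _ => ?_
  have h1 := hasSum_comp_mul_left₀ (inv_ne_zero α.ne_zero)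
    (summable_thetaTerm (σ := σ) (k := k) hm (hr μ) h τ).hasSum
  exact (h1.mul_left _).mul_left _

/-- The reindexed theta series is the series over `B` plus a term supported at `y = 0`; that term is
removed on both sides. -/
theorem hasSum_thetaSum [Fintype (𝓞 K ⧸ m)ˣ] (hm : m ≠ ⊥) (hk : 1 ≤ k)
    {t : (FiniteAdeleRing (𝓞 K) K)ˣ} (h : (FiniteAdeleRing (𝓞 K) K)ˣ) {α : Kˣ}
    (ht : t ∈ coprimeIdeles m)
    (hα : FiniteAdeleRing.unitEmbedding (𝓞 K) K α * normMinus K h ∈ coprimeIdeles m)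
    {r : (𝓞 K ⧸ m)ˣ → Kˣ} (hr : ∀ μ, (r μ : K) ∈ (ideleIdeal t : FractionalIdeal (𝓞 K)⁰ K) ∧
      ∃ z : 𝓞 K, algebraMap (𝓞 K) K z = r μ ∧ Ideal.Quotient.mk m z = μ) (τ : ℍ) :
    HasSum (classTerm ϱ τ
      (ideleIdeal (FiniteAdeleRing.unitEmbedding (𝓞 K) K α * normMinus K h * t)))
      (thetaSum ϱ t h r τ - constClass ϱ (ideleClass K (t * normMinus K h))) := by
  classical
  have h1 := hasSum_sum_thetaTerm ϱ hm h α (fun μ => (hr μ).1) τ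
  rw [funext (sum_thetaTerm ϱ hm hk ht hα hr τ)] at h1
  have hc := constClass_mk ϱ hm
    (ideleIdeal (FiniteAdeleRing.unitEmbedding (𝓞 K) K α * normMinus K h * t))
  rw [ideleClass_unitEmbedding_mul] at hc
  rw [hc]
  generalize ideleIdeal (FiniteAdeleRing.unitEmbedding (𝓞 K) K α * normMinus K h * t) = B at h1 ⊢
  have h2 := h1.sub (hasSum_ite_eq (0 : K) (constTerm ϱ B))
  simpa only [add_sub_cancel_right] using h2

/-- The auxiliary `α` changes `B` only within its ideal class, and the residue representatives have
disappeared. Afterwards only finite averages over classes remain. -/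
theorem thetaSum_eq [Fintype (𝓞 K ⧸ m)ˣ] (hm : m ≠ ⊥) (hk : 1 ≤ k)
    {t : (FiniteAdeleRing (𝓞 K) K)ˣ} (h : (FiniteAdeleRing (𝓞 K) K)ˣ)
    (ht : t ∈ coprimeIdeles m)
    {r : (𝓞 K ⧸ m)ˣ → Kˣ} (hr : ∀ μ, (r μ : K) ∈ (ideleIdeal t : FractionalIdeal (𝓞 K)⁰ K) ∧
      ∃ z : 𝓞 K, algebraMap (𝓞 K) K z = r μ ∧ Ideal.Quotient.mk m z = μ) (τ : ℍ) :
    thetaSum ϱ t h r τ = classValue ϱ τ (ideleClass K (t * normMinus K h)) := by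
  obtain ⟨α, hα⟩ := exists_unitEmbedding_mul_mem_coprimeIdeles hm (normMinus K h)
  have h1 := hasSum_thetaSum ϱ hm hk h ht hα hr τ
  have h2 := h1.tsum_eq.symm.trans (tsum_classTerm ϱ h1.summable)
  rw [ideleClass_unitEmbedding_mul] at h2
  rw [classValue, ← h2, sub_add_cancel]

theorem summable_formTerm_of_thetaSum [Fintype (𝓞 K ⧸ m)ˣ] (hm : m ≠ ⊥) (hk : 1 ≤ k)
    {t : (FiniteAdeleRing (𝓞 K) K)ˣ} (h : (FiniteAdeleRing (𝓞 K) K)ˣ)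
    (ht : t ∈ coprimeIdeles m)
    {r : (𝓞 K ⧸ m)ˣ → Kˣ} (hr : ∀ μ, (r μ : K) ∈ (ideleIdeal t : FractionalIdeal (𝓞 K)⁰ K) ∧
      ∃ z : 𝓞 K, algebraMap (𝓞 K) K z = r μ ∧ Ideal.Quotient.mk m z = μ) (τ : ℍ) :
    Summable fun a : {a : (Ideal (𝓞 K))⁰ //
      ClassGroup.mk0 a = (ideleClass K (t * normMinus K h))⁻¹} => ϱ.formTerm τ a.1 := by
  obtain ⟨α, hα⟩ := exists_unitEmbedding_mul_mem_coprimeIdeles hm (normMinus K h)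
  have h1 := summable_formTerm_class ϱ (hasSum_thetaSum ϱ hm hk h ht hα hr τ).summable
  rwa [ideleClass_unitEmbedding_mul] at h1

end Averages

end CMTheta
end

noncomputable section
namespace CMTheta

/-! ### Counting classes for the two formulas. -/

section MainFormulas

variable {K : Type*} [Field K] [NumberField K] [Algebra.IsQuadraticExtension ℚ K]
  [IsTotallyComplex K] {m : Ideal (𝓞 K)} {ℓ n : ℕ} {t : Fin ℓ → (FiniteAdeleRing (𝓞 K) K)ˣ}
  {h : Fin n → (FiniteAdeleRing (𝓞 K) K)ˣ}

theorem sum_representatives [Fintype (ClassGroup (𝓞 K))] [Fintype (IdeleClassGroup (levelSubgroup m))]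
    (hreps : Function.Bijective fun p : Fin ℓ × Fin n =>
      (QuotientGroup.mk (t p.1 * normMinus K (h p.2)) : IdeleClassGroup (levelSubgroup m)))
    (F : ClassGroup (𝓞 K) → ℂ) :
    (Fintype.card (ClassGroup (𝓞 K)) : ℂ) *
      ∑ i, ∑ j, F (ideleClass K (t i * normMinus K (h j))) =
        Fintype.card (IdeleClassGroup (levelSubgroup m)) * ∑ d, F d := by
  rw [← card_mul_sum_comp (classMap (levelSubgroup_le m)) (classMap_surjective _) F,
    ← Fintype.sum_prod_type']
  congr 1
  exact Function.Bijective.sum_comp hreps fun c => F (classMap (levelSubgroup_le m) c)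

/-- For a fixed `i` the classes of `t_i Nm⁻(c)` need not be equidistributed. Translating `c` by each
`h_j` leaves the sum over `c` unchanged and adds an average over `j`. Then for each fixed `c` the
double sum over `i, j` runs over all representatives, and dividing by `n` turns `ℓn` into `ℓ`. -/
theorem sum_classGroup_twisted [Fintype (ClassGroup (𝓞 K))]
    [Fintype (IdeleClassGroup (levelSubgroup m))]
    (hreps : Function.Bijective fun p : Fin ℓ × Fin n =>
      (QuotientGroup.mk (t p.1 * normMinus K (h p.2)) : IdeleClassGroup (levelSubgroup m)))
    {Kf : Subgroup (FiniteAdeleRing (𝓞 K) K)ˣ} (hle : Kf ≤ integralUnits K)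
    [Fintype (IdeleClassGroup Kf)] (F : ClassGroup (𝓞 K) → ℂ) :
    (Fintype.card (ClassGroup (𝓞 K)) : ℂ) *
      ∑ i, ∑ c : IdeleClassGroup Kf, F (ideleClass K (t i * normMinus K c.out)) =
        ℓ * Fintype.card (IdeleClassGroup Kf) * ∑ d, F d := by
  have hcard : (ℓ : ℂ) * n = Fintype.card (IdeleClassGroup (levelSubgroup m)) := by
    rw [← Fintype.card_of_bijective hreps]
    simp
  have hn : (n : ℂ) ≠ 0 := fun h0 => by
    rw [h0, mul_zero] at hcard
    exact Fintype.card_ne_zero (by exact_mod_cast hcard.symm)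
  have htrans : ∀ i j, ∑ c : IdeleClassGroup Kf, F (ideleClass K (t i * normMinus K c.out)) =
      ∑ c : IdeleClassGroup Kf,
        F (ideleClass K (t i * normMinus K (h j)) * normMinusClassMap hle c) := by
    intro i j
    rw [← Equiv.sum_comp (Equiv.mulLeft (QuotientGroup.mk (h j) : IdeleClassGroup Kf))]
    refine Finset.sum_congr rfl fun c _ => ?_
    rw [map_mul, normMinusClassMap_out hle, Equiv.coe_mulLeft, map_mul, map_mul, mul_assoc]
    rfl
  have h1 : (n : ℂ) * ∑ i, ∑ c : IdeleClassGroup Kf, F (ideleClass K (t i * normMinus K c.out)) =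
      ∑ c : IdeleClassGroup Kf, ∑ i, ∑ j,
        F (ideleClass K (t i * normMinus K (h j)) * normMinusClassMap hle c) := by
    rw [Finset.mul_sum]
    refine (Finset.sum_congr rfl fun i _ => ?_).trans Finset.sum_comm
    rw [Finset.sum_comm, ← Finset.sum_congr rfl fun j _ => htrans i j]
    simp
  have h2 : ∀ c : IdeleClassGroup Kf, (Fintype.card (ClassGroup (𝓞 K)) : ℂ) * ∑ i, ∑ j,
      F (ideleClass K (t i * normMinus K (h j)) * normMinusClassMap hle c) =
        ℓ * n * ∑ d, F d := by
    intro c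
    rw [sum_representatives hreps fun d => F (d * normMinusClassMap hle c), hcard]
    congr 1
    exact Equiv.sum_comp (Equiv.mulRight (normMinusClassMap hle c)) F
  apply mul_left_cancel₀ hn
  rw [mul_left_comm, h1, Finset.mul_sum, Finset.sum_congr rfl fun c _ => h2 c, Finset.sum_const,
    Finset.card_univ, nsmul_eq_mul]
  ring

variable {σ : K →+* ℂ} {k : ℕ} (ϱ : HeckeCharacter σ k m)

/-- Every ideal class is that of some `t_i h_j/h̄_j`, so convergence on each class follows from that
of a theta series. -/
theorem summable_formTerm_of_representatives [Fintype (𝓞 K ⧸ m)ˣ] (hm : m ≠ ⊥) (hk : 1 ≤ k)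
    (ht : ∀ i, t i ∈ coprimeIdeles m)
    (hreps : Function.Bijective fun p : Fin ℓ × Fin n =>
      (QuotientGroup.mk (t p.1 * normMinus K (h p.2)) : IdeleClassGroup (levelSubgroup m)))
    {r : Fin ℓ → (𝓞 K ⧸ m)ˣ → Kˣ}
    (hr : ∀ i μ, (r i μ : K) ∈ (ideleIdeal (t i) : FractionalIdeal (𝓞 K)⁰ K) ∧
      ∃ y : 𝓞 K, algebraMap (𝓞 K) K y = r i μ ∧ Ideal.Quotient.mk m y = μ) (τ : ℍ) :
    Summable (ϱ.formTerm τ) := by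
  refine summable_formTerm ϱ fun d => ?_
  obtain ⟨g, hg⟩ := ideleClass_surjective d⁻¹
  obtain ⟨⟨i, j⟩, hij⟩ := hreps.2 (QuotientGroup.mk g)
  have h1 : ideleClass K (t i * normMinus K (h j)) = d⁻¹ :=
    (congrArg (classMap (levelSubgroup_le m)) hij).trans hg
  have h2 := summable_formTerm_of_thetaSum ϱ hm hk (h j) (ht i) (hr i) τ
  rwa [h1, inv_inv] at h2

theorem mul_sum_thetaSum [Fintype (𝓞 K ⧸ m)ˣ] {ι : Type*} [Fintype ι] (v : ℂ)
    (g : ι → (FiniteAdeleRing (𝓞 K) K)ˣ) (s : (FiniteAdeleRing (𝓞 K) K)ˣ)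
    (r : (𝓞 K ⧸ m)ˣ → Kˣ) (τ : ℍ) :
    ∑ᶠ μ : (𝓞 K ⧸ m)ˣ, (ϱ.onIdele s)⁻¹ * ϱ.eta (r μ) * (v * ∑ c,
      (ϱ.onIdele (normMinus K (g c)))⁻¹ *
        theta σ k (FractionalIdeal.absNorm (ideleIdeal s : FractionalIdeal (𝓞 K)⁰ K))⁻¹
          (cosetIndicator ((m : FractionalIdeal (𝓞 K)⁰ K) *
            (ideleIdeal s : FractionalIdeal (𝓞 K)⁰ K)) (r μ)) (g c) τ) =
      v * ∑ c, thetaSum ϱ s (g c) r τ := by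
  simp only [thetaSum]
  rw [finsum_eq_sum_of_fintype, Finset.sum_comm, Finset.mul_sum]
  refine Finset.sum_congr rfl fun μ _ => ?_
  rw [← Finset.mul_sum]
  ring

end MainFormulas

end CMTheta
end

theorem mainTheorem8 {K : Type*} [Field K] [NumberField K] [Algebra.IsQuadraticExtension ℚ K]
    [IsTotallyComplex K] (σ : K →+* ℂ) (k : ℕ) (hk : 1 ≤ k)
    (m : Ideal (𝓞 K)) (hm : m ≠ ⊥)
    (ϱ : CMTheta.HeckeCharacter σ k m) (hmod : ϱ.HasModulus)
    (hϱ : k = 1 → ∃ a, ϱ.toHom a ≠ 1)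
    {ℓ n : ℕ} (t : Fin ℓ → (FiniteAdeleRing (𝓞 K) K)ˣ) (h : Fin n → (FiniteAdeleRing (𝓞 K) K)ˣ)
    (ht : ∀ i, t i ∈ CMTheta.coprimeIdeles m) (hh : ∀ j, h j ∈ CMTheta.coprimeIdeles m)
    (hreps : Function.Bijective fun p : Fin ℓ × Fin n =>
      (QuotientGroup.mk (t p.1 * CMTheta.normMinus K (h p.2)) :
        CMTheta.IdeleClassGroup (CMTheta.levelSubgroup m)))
    (A : Fin ℓ → FractionalIdeal (𝓞 K)⁰ K) (hA : ∀ i, A i = CMTheta.ideleIdeal (t i))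
    (r : Fin ℓ → (𝓞 K ⧸ m)ˣ → Kˣ)
    (hr : ∀ i μ, (r i μ : K) ∈ A i ∧
      ∃ y : 𝓞 K, algebraMap (𝓞 K) K y = r i μ ∧ Ideal.Quotient.mk m y = μ)
    (φ : Fin ℓ → (𝓞 K ⧸ m)ˣ → FiniteAdeleRing (𝓞 K) K → ℂ)
    (hφ : ∀ i μ, φ i μ = CMTheta.cosetIndicator ((m : FractionalIdeal (𝓞 K)⁰ K) * A i) (r i μ))
    (τ : ℍ) :
    Summable (ϱ.formTerm τ) ∧
    (∀ i μ g, Summable (CMTheta.thetaTerm σ k (FractionalIdeal.absNorm (A i))⁻¹ (φ i μ) g τ)) ∧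
    (∀ Kf : Subgroup (FiniteAdeleRing (𝓞 K) K)ˣ, (∀ i μ, CMTheta.IsLevel ϱ (φ i μ) Kf) →
      ϱ.form τ = ((ℓ : ℂ) * (Nat.card (𝓞 K)ˣ : ℂ))⁻¹ * ∑ i, ∑ᶠ μ : (𝓞 K ⧸ m)ˣ,
        (ϱ.onIdele (t i))⁻¹ * ϱ.eta (r i μ) *
          CMTheta.twistedTheta ϱ Kf (FractionalIdeal.absNorm (A i))⁻¹ (φ i μ) τ) ∧
    ϱ.form τ = (Nat.card (𝓞 K)ˣ : ℂ)⁻¹ * ∑ i, ∑ᶠ μ : (𝓞 K ⧸ m)ˣ,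
      (ϱ.onIdele (t i))⁻¹ * ϱ.eta (r i μ) *
        (CMTheta.vol (CMTheta.levelSubgroup m) *
          ∑ j, (ϱ.onIdele (CMTheta.normMinus K (h j)))⁻¹ *
            CMTheta.theta σ k (FractionalIdeal.absNorm (A i))⁻¹ (φ i μ) (h j) τ) := by
  have : Finite (𝓞 K ⧸ m) := Ideal.finiteQuotientOfFreeOfNeBot m hm
  have := Fintype.ofFinite (𝓞 K ⧸ m)ˣ
  have := CMTheta.finite_units K
  have : Finite (CMTheta.IdeleClassGroup (CMTheta.levelSubgroup m)) :=
    Finite.of_surjective _ hreps.2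
  have := Fintype.ofFinite (CMTheta.IdeleClassGroup (CMTheta.levelSubgroup m))
  have hh0 : (Fintype.card (ClassGroup (𝓞 K)) : ℂ) ≠ 0 := Nat.cast_ne_zero.2 Fintype.card_ne_zero
  have hw0 : (Nat.card (𝓞 K)ˣ : ℂ) ≠ 0 := Nat.cast_ne_zero.2 Nat.card_pos.ne'
  have hℓ0 : (ℓ : ℂ) ≠ 0 := by
    obtain ⟨⟨i, -⟩, -⟩ := hreps.2 1
    exact Nat.cast_ne_zero.2 (Fin.pos i).ne'
  have hr' : ∀ i μ, (r i μ : K) ∈ (CMTheta.ideleIdeal (t i) : FractionalIdeal (𝓞 K)⁰ K) ∧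
      ∃ y : 𝓞 K, algebraMap (𝓞 K) K y = r i μ ∧ Ideal.Quotient.mk m y = μ := fun i μ => by
    rw [← hA]
    exact hr i μ
  have hsum := CMTheta.summable_formTerm_of_representatives ϱ hm hk ht hreps hr' τ
  have hW := CMTheta.sum_classValue ϱ hm hϱ hsum
  refine ⟨hsum, fun i μ g => ?_, fun Kf hKf => ?_, ?_⟩
  · rw [hφ, hA]
    exact CMTheta.summable_thetaTerm hm (hr' i μ).1 g τ
  -- The level conditions are indexed by `i` and `μ`; reading off that `K_f` is open and integral
  -- requires one index to exist.
  · obtain ⟨⟨i₀, -⟩, -⟩ := hreps.2 1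
    have hle := (hKf i₀ 1).le_integralUnits
    have hidx := CMTheta.relIndex_ne_zero_of_isOpen (hKf i₀ 1).isOpen
    have := CMTheta.finite_ideleClassGroup hle hidx
    have := Fintype.ofFinite (CMTheta.IdeleClassGroup Kf)
    have hvol := CMTheta.vol_mul_index hle hidx
    rw [Nat.card_eq_fintype_card, Nat.card_eq_fintype_card] at hvol
    have hS := CMTheta.sum_classGroup_twisted hreps hle (CMTheta.classValue ϱ τ)
    have hI : ∀ i, ∑ᶠ μ : (𝓞 K ⧸ m)ˣ, (ϱ.onIdele (t i))⁻¹ * ϱ.eta (r i μ) *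
        CMTheta.twistedTheta ϱ Kf (FractionalIdeal.absNorm (A i))⁻¹ (φ i μ) τ =
        CMTheta.vol Kf * ∑ c : CMTheta.IdeleClassGroup Kf, CMTheta.classValue ϱ τ
          (CMTheta.ideleClass K (t i * CMTheta.normMinus K c.out)) := by
      intro i
      have hc : ∀ c : CMTheta.IdeleClassGroup Kf, CMTheta.classValue ϱ τ
          (CMTheta.ideleClass K (t i * CMTheta.normMinus K c.out)) =
            CMTheta.thetaSum ϱ (t i) c.out (r i) τ := fun c =>
        (CMTheta.thetaSum_eq ϱ hm hk c.out (ht i) (hr' i) τ).symm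
      rw [Finset.sum_congr rfl fun c _ => hc c, ← CMTheta.mul_sum_thetaSum]
      refine finsum_congr fun μ => ?_
      rw [CMTheta.twistedTheta, finsum_eq_sum_of_fintype, hφ, hA]
    rw [Finset.sum_congr rfl fun i _ => hI i, ← Finset.mul_sum]
    rw [hW, ← hvol] at hS
    rw [← hvol] at hh0
    -- With the class number written as `Vol(K_f) |Cl(K_f)|`, the cardinality of `Cl(K_f)` cancels
    -- from both sides and the volume stays.
    have hS' : CMTheta.vol Kf * ∑ i, ∑ c : CMTheta.IdeleClassGroup Kf, CMTheta.classValue ϱ τ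
        (CMTheta.ideleClass K (t i * CMTheta.normMinus K c.out)) =
          ℓ * (Nat.card (𝓞 K)ˣ * ϱ.form τ) := by
      apply mul_left_cancel₀ (right_ne_zero_of_mul hh0)
      linear_combination hS
    rw [hS']
    field_simp
  · have hvol := CMTheta.vol_mul_index (CMTheta.levelSubgroup_le m)
      (CMTheta.relIndex_ne_zero_of_finite (CMTheta.levelSubgroup_le m))
    rw [Nat.card_eq_fintype_card, Nat.card_eq_fintype_card] at hvol
    have hS := CMTheta.sum_representatives hreps (CMTheta.classValue ϱ τ)
    have hI : ∀ i, ∑ᶠ μ : (𝓞 K ⧸ m)ˣ, (ϱ.onIdele (t i))⁻¹ * ϱ.eta (r i μ) *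
        (CMTheta.vol (CMTheta.levelSubgroup m) *
          ∑ j, (ϱ.onIdele (CMTheta.normMinus K (h j)))⁻¹ *
            CMTheta.theta σ k (FractionalIdeal.absNorm (A i))⁻¹ (φ i μ) (h j) τ) =
        CMTheta.vol (CMTheta.levelSubgroup m) * ∑ j, CMTheta.classValue ϱ τ
          (CMTheta.ideleClass K (t i * CMTheta.normMinus K (h j))) := by
      intro i
      rw [Finset.sum_congr rfl fun j _ =>
        (CMTheta.thetaSum_eq ϱ hm hk (h j) (ht i) (hr' i) τ).symm,
        ← CMTheta.mul_sum_thetaSum]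
      refine finsum_congr fun μ => ?_
      rw [hφ, hA]
    rw [Finset.sum_congr rfl fun i _ => hI i, ← Finset.mul_sum]
    rw [hW, ← hvol] at hS
    rw [← hvol] at hh0
    -- The same cancellation at level `K(𝔪)`; here each representative is used once, so no factor
    -- `ℓ` arises.
    have hS' : CMTheta.vol (CMTheta.levelSubgroup m) * ∑ i, ∑ j, CMTheta.classValue ϱ τ
        (CMTheta.ideleClass K (t i * CMTheta.normMinus K (h j))) =
          Nat.card (𝓞 K)ˣ * ϱ.form τ := by
      apply mul_left_cancel₀ (right_ne_zero_of_mul hh0)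
      linear_combination hS
    rw [hS']
    field_simp
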